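/- For a set $E\subset\mathbb{R}^2$ let $P(E)=\sup\{\int_E \operatorname{div}\varphi\,dx : \varphi\in C^1_c(\mathbb{R}^2;\mathbb{R}^2),\ |\varphi|\le 1\}\in[0,\infty]$ be its perimeter. Let the connected perimeter and the simply connected perimeter of $E$ be $$\overline{P^r_C}(E)=\inf\{\liminf_{n\to\infty}P(E_n) : E_n\to E\text{ in }L^1,\ E_n\text{ connected and }C^\infty\text{-smooth}\},$$ $$\overline{P^r_S}(E)=\inf\{\liminf_{n\to\infty}P(E_n) : E_n\to E\text{ in }L^1,\ E_n\text{ simply connected and }C^\infty\text{-smooth}\},$$ where a $C^\infty$-smooth set is a (nonempty) open set with $C^\infty$ boundary, lying locally on one side of it, and $E_n\to E$ in $L^1$ means $|E_n\triangle E|\to 0$. For $\lambda>0$ and measurable $E$ with $|E|<\infty$ let $$\mathcal F^\lambda_{C}(E)=\overline{P^r_{C}}(E)+\lambda\int_E\int_E\log\frac1{|x-y|}\,dx\,dy,\qquad \mathcal F^\lambda_{S}(E)=\overline{P^r_{S}}(E)+\lambda\int_E\int_E\log\frac1{|x-y|}\,dx\,dy,$$ with $\mathcal F^\lambda_{C}(E)=+\infty$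 if $\overline{P^r_{C}}(E)=\infty$, and $\mathcal F^\lambda_{S}(E)=+\infty$ if $\overline{P^r_{S}}(E)=\infty$. Let $$\operatorname{diam}(E)=\sup\{|x-y| : |E\cap B_r(x)|>0\text{ and }|E\cap B_r(y)|>0\text{ for all }r>0\}.$$ **Theorem.** Let $m>0$ and $\lambda>0$. Each of the two minimization problems $$\min\{\mathcal F^\lambda_C(E) : E\subset\mathbb{R}^2\text{ measurable},\ |E|=m\},\qquad \min\{\mathcal F^\lambda_S(E) : E\subset\mathbb{R}^2\text{ measurable},\ |E|=m\}$$ admits a solution, and the minimum values are finite. Furthermore, there is a constant $C>0$, depending only on $m$ and $\lambda$, such that every solution $E$ of either problem satisfies $\operatorname{diam}(E)<C$. -/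

import Mathlib

open MeasureTheory Filter Topology Set
open scoped ENNReal ContDiff

noncomputable section

namespace ConnPerim

/-- The Euclidean plane. -/
abbrev Plane : Type := EuclideanSpace ℝ (Fin 2)

/-- The divergence of a vector field on the plane. -/
def divergence (φ : Plane → Plane) (x : Plane) : ℝ :=
  ∑ i : Fin 2, (fderiv ℝ φ x (EuclideanSpace.single i 1)) i

/-- The usual (De Giorgi) perimeter: the supremum of `∫_E div φ` over compactly supported `C¹`
vector fields `φ` with `|φ| ≤ 1`. -/
def perimeter (E : Set Plane) : ℝ≥0∞ :=
  ⨆ (φ : Plane → Plane) (_ : ContDiff ℝ 1 φ ∧ HasCompactSupport φ ∧ ∀ x, ‖φ x‖ ≤ 1),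
    ENNReal.ofReal (∫ x in E, divergence φ x)

/-- `C^∞`-smooth sets: open sets which, near each boundary point, are the sublevel set `{ψ < 0}`
of a smooth function `ψ` with nonvanishing differential (equivalently, lie locally on one side of
the graph of a smooth function). -/
def IsSmoothSet (E : Set Plane) : Prop :=
  IsOpen E ∧ ∀ x ∈ frontier E, ∃ ψ : Plane → ℝ, ContDiff ℝ ∞ ψ ∧ fderiv ℝ ψ x ≠ 0 ∧
    ∀ᶠ y in 𝓝 x, (y ∈ E ↔ ψ y < 0)

/-- The `L¹`-relaxation of the perimeter with respect to the sets satisfying `A`: the infimum of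
`liminf P(Eₙ)` over sequences of such sets converging to `E` in `L¹`. -/
def relaxedPerimeter (A : Set Plane → Prop) (E : Set Plane) : ℝ≥0∞ :=
  ⨅ (F : ℕ → Set Plane)
    (_ : (∀ n, A (F n)) ∧ Tendsto (fun n => volume (symmDiff (F n) E)) atTop (𝓝 0)),
    liminf (fun n => perimeter (F n)) atTop

/-- The connected perimeter. -/
def connectedPerimeter : Set Plane → ℝ≥0∞ :=
  relaxedPerimeter fun F => IsConnected F ∧ IsSmoothSet F

/-- The simply connected perimeter. -/
def simplyConnectedPerimeter : Set Plane → ℝ≥0∞ :=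
  relaxedPerimeter fun F => IsSimplyConnected F ∧ IsSmoothSet F

/-- The logarithmic self-interaction `∫_E ∫_E log (1 / |x - y|) dx dy`, as the integral of the
positive part minus the integral of the negative part of the kernel. For `E` of finite measure the
first one is finite, so that the difference is meaningful, with values in `[-∞, ∞)`. -/
def logInteraction (E : Set Plane) : EReal :=
  ((∫⁻ x in E, ∫⁻ y in E, ENNReal.ofReal (Real.log (1 / ‖x - y‖)) : ℝ≥0∞) : EReal) -
    ((∫⁻ x in E, ∫⁻ y in E, ENNReal.ofReal (-Real.log (1 / ‖x - y‖)) : ℝ≥0∞) : EReal)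

open Classical in
/-- The energy `P(E) + lam * ∫_E ∫_E log (1 / |x - y|) dx dy` for a perimeter-like functional `P`.
It is `+∞` where `P(E) = ∞` (even if the interaction is `-∞`). -/
def energy (P : Set Plane → ℝ≥0∞) (lam : ℝ) (E : Set Plane) : EReal :=
  if P E = ⊤ then ⊤ else (P E : EReal) + (lam : EReal) * logInteraction E

/-- The competitors: measurable sets of mass `m`. -/
def IsAdmissible (m : ℝ) (E : Set Plane) : Prop :=
  MeasurableSet E ∧ volume E = ENNReal.ofReal m

/-- `E` minimizes the energy among all measurable sets of mass `m`. -/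
def IsMinimizer (P : Set Plane → ℝ≥0∞) (m lam : ℝ) (E : Set Plane) : Prop :=
  IsAdmissible m E ∧ ∀ F : Set Plane, IsAdmissible m F → energy P lam E ≤ energy P lam F

/-- The diameter of a set modulo null sets: the diameter of the set of those points all of whose
neighbourhoods meet `E` in positive measure. -/
def essDiam (E : Set Plane) : ℝ≥0∞ :=
  Metric.ediam {x : Plane | ∀ r : ℝ, 0 < r → 0 < volume (E ∩ Metric.ball x r)}

end ConnPerim

end

namespace ConnPerim

/-! The only obstruction to the direct method is spreading: the logarithmic interaction tends to
`-∞` when mass escapes to infinity. Connectedness prevents this. A connected open set of finite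
measure projects onto an interval on each axis, and the length of a projection is at most the
perimeter; so its diameter is at most twice its perimeter, and this passes to the relaxed perimeter
`P` (`essDiam_le`).

The negative part of the interaction is therefore at most `m² log (2P + 1)`. Since a logarithm is
absorbed by half of `P`, the energy is at least `P / 2 - K` with `K` depending only on `m` and `lam`
(`exists_perimeter_le_two_mul_energy_add`). This bounds the energy from below, bounds the perimeter
along minimizing sequences, and, by comparison with one fixed competitor, bounds the diameter of
every minimizer.

For existence (`exists_realEnergy_le_of_tendsto`), each member of a minimizing sequence is replaced
by a nearby smooth connected set, translated so as to contain the origin. These sets lie in one ball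
and have bounded perimeter, hence are precompact in `L¹`. The interaction passes to the limit: the
positive part of the kernel is integrable, and on sets of bounded diameter the negative part may be
cut off to become integrable. The approximants compete in the relaxation at the limit set, which
gives the inequality for the perimeter.

Smoothness and simple connectedness play no role in the argument beyond the properties in
`IsApproxClass`, so both problems are treated at once. -/

/-! ### Perimeter controls translations in `L¹` -/

lemma divergence_smul_const {ψ : Plane → ℝ} (hψ : Differentiable ℝ ψ) (u x : Plane) :
    divergence (fun y => ψ y • u) x = fderiv ℝ ψ x u := by
  have h : fderiv ℝ (fun y => ψ y • u) x = (fderiv ℝ ψ x).smulRight u := by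
    rw [fderiv_smul_const (hψ x)]
  have hu : u = ∑ i, u i • EuclideanSpace.single i (1 : ℝ) := by
    ext j; fin_cases j <;> simp
  conv_rhs => rw [hu]
  simp [divergence, h, mul_comm]

lemma ofReal_integral_divergence_le (E : Set Plane) {φ : Plane → Plane} (h1 : ContDiff ℝ 1 φ)
    (h2 : HasCompactSupport φ) (h3 : ∀ x, ‖φ x‖ ≤ 1) :
    ENNReal.ofReal (∫ x in E, divergence φ x) ≤ perimeter E :=
  le_iSup₂_of_le (f := fun φ (_ : ContDiff ℝ 1 φ ∧ HasCompactSupport φ ∧ ∀ x, ‖φ x‖ ≤ 1) =>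
    ENNReal.ofReal (∫ x in E, divergence φ x)) φ ⟨h1, h2, h3⟩ le_rfl

lemma integral_fderiv_le_perimeter (E : Set Plane) (hE : perimeter E ≠ ⊤) {ψ : Plane → ℝ}
    (h1 : ContDiff ℝ 1 ψ) (h2 : HasCompactSupport ψ) (h3 : ∀ x, |ψ x| ≤ 1) (v : Plane) :
    ∫ x in E, fderiv ℝ ψ x v ≤ ‖v‖ * (perimeter E).toReal := by
  by_cases hv : v = 0
  · simp [hv]
  have hv' : 0 < ‖v‖ := norm_pos_iff.2 hv
  set u : Plane := ‖v‖⁻¹ • v with hu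
  have hvu : v = ‖v‖ • u := by rw [hu, smul_smul, mul_inv_cancel₀ hv'.ne', one_smul]
  have hnu : ‖u‖ = 1 := by rw [hu, norm_smul, norm_inv, norm_norm, inv_mul_cancel₀ hv'.ne']
  have key := ofReal_integral_divergence_le E (φ := fun y => ψ y • u) (h1.smul contDiff_const)
    h2.smul_right (fun x => by rw [norm_smul, hnu, mul_one]; exact h3 x)
  rw [ENNReal.ofReal_le_iff_le_toReal hE] at key
  simp_rw [divergence_smul_const (h1.differentiable one_ne_zero)] at key
  rw [hvu]
  simp_rw [map_smul, smul_eq_mul]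
  rw [integral_const_mul, ← hvu]
  gcongr

/-- The difference is the integral of the directional derivative along the segment from `x - v` to
`x`. After exchanging integrals, each time slice tests the perimeter with a translate of `ψ`. -/
lemma integral_sub_translate_le {F : Set Plane} (hF' : volume F ≠ ⊤)
    (hP : perimeter F ≠ ⊤) {ψ : Plane → ℝ} (h1 : ContDiff ℝ 1 ψ) (h2 : HasCompactSupport ψ)
    (h3 : ∀ x, |ψ x| ≤ 1) (v : Plane) :
    ∫ x in F, (ψ x - ψ (x - v)) ≤ ‖v‖ * (perimeter F).toReal := by
  have hdiff := h1.differentiable one_ne_zero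
  have hcont := h1.continuous_fderiv one_ne_zero
  have hline : ∀ x (s : ℝ), HasDerivAt (fun s : ℝ => ψ (x - v + s • v))
      (fderiv ℝ ψ (x - v + s • v) v) s := by
    intro x s
    have : HasDerivAt (fun s : ℝ => x - v + s • v) v s := by
      simpa using ((hasDerivAt_id s).smul_const v).const_add (x - v)
    exact (hdiff _).hasFDerivAt.comp_hasDerivAt s this
  have hFTC : ∀ x, ψ x - ψ (x - v) = ∫ s in Ioc (0 : ℝ) 1, fderiv ℝ ψ (x - v + s • v) v := by
    intro x
    have := intervalIntegral.integral_eq_sub_of_hasDerivAt (a := 0) (b := 1)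
      (fun s _ => hline x s) (Continuous.intervalIntegrable (by fun_prop) _ _)
    rw [intervalIntegral.integral_of_le zero_le_one] at this
    rw [this]; simp
  obtain ⟨C, hC⟩ := (h2.fderiv (𝕜 := ℝ)).exists_bound_of_continuous hcont
  have : IsFiniteMeasure (volume.restrict F) := ⟨by simpa using hF'.lt_top⟩
  simp_rw [hFTC]
  rw [integral_integral_swap]
  · have hb : ∀ s : ℝ, ∫ x in F, fderiv ℝ ψ (x - v + s • v) v ≤ ‖v‖ * (perimeter F).toReal := by
      intro s
      have hc : ContDiff ℝ 1 (fun x => ψ (x + (s • v - v))) := by fun_prop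
      have := integral_fderiv_le_perimeter F hP hc
        (h2.comp_homeomorph (Homeomorph.addRight (s • v - v))) (fun x => h3 _) v
      simp_rw [fderiv_comp_add_right] at this
      simpa only [add_sub, add_comm, add_left_comm, sub_eq_add_neg, add_assoc] using this
    calc _ ≤ ∫ s in Ioc (0 : ℝ) 1, ‖v‖ * (perimeter F).toReal := by
          by_cases hi : IntegrableOn (fun s : ℝ => ∫ x in F, fderiv ℝ ψ (x - v + s • v) v)
              (Ioc 0 1)
          · exact integral_mono hi (integrable_const _) hb
          -- A non-integrable function has integral `0` by convention, so nonnegativity of the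
          -- right-hand side suffices.
          · rw [integral_undef hi]; simpa using by positivity
      _ = _ := by simp
  · refine Integrable.of_bound (C := C * ‖v‖) (Continuous.aestronglyMeasurable ?_) ?_
    · simp only [Function.uncurry_def]; fun_prop
    · exact ae_of_all _ fun p => ((fderiv ℝ ψ _).le_opNorm v).trans (by gcongr; exact hC _)

lemma exists_contDiff_bump {K U : Set Plane} (hK : IsCompact K) (hU : IsOpen U) (h : K ⊆ U) :
    ∃ ψ : Plane → ℝ, ContDiff ℝ 1 ψ ∧ HasCompactSupport ψ ∧ (∀ x, ψ x ∈ Icc (0 : ℝ) 1) ∧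
      (∀ x ∈ K, ψ x = 1) ∧ ∀ x, x ∉ U → ψ x = 0 := by
  obtain ⟨V, hV, hKV, hVU, hVc⟩ := exists_open_between_and_isCompact_closure hK hU h
  obtain ⟨f, h0, h1, h2⟩ := exists_contMDiffMap_zero_one_of_isClosed (n := 1)
    (modelWithCornersSelf ℝ Plane) hV.isClosed_compl hK.isClosed
    (disjoint_compl_left_iff_subset.2 hKV)
  refine ⟨f, f.contMDiff.contDiff, ?_, h2, fun x hx => h1 hx, fun x hx => h0 ?_⟩
  · exact HasCompactSupport.intro hVc fun x hx => h0 fun hx' => hx (subset_closure hx')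
  · exact fun hx' => hx (hVU (subset_closure hx'))

/-- With `G` the translated set and `ψ` a smooth approximation of the indicator of `F \ G`, the
quantity `∫_F ψ - ∫_G ψ` is nearly the measure of `F \ G`, and it is bounded by the translation
estimate for test functions. -/
lemma volume_real_sdiff_translate_le {F : Set Plane} (hF : MeasurableSet F) (hF' : volume F ≠ ⊤)
    (hP : perimeter F ≠ ⊤) (v : Plane) :
    volume.real (F \ (fun x => x + v) ⁻¹' F) ≤ ‖v‖ * (perimeter F).toReal := by
  set G : Set Plane := (fun x => x + v) ⁻¹' F with hG
  have hmp : MeasurePreserving (fun x : Plane => x + v) := measurePreserving_add_right volume v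
  have hGm : MeasurableSet G := hmp.measurable hF
  have hG' : volume G ≠ ⊤ := by rwa [hG, hmp.measure_preimage hF.nullMeasurableSet]
  set A := F \ G with hA
  have hAm : MeasurableSet A := hF.diff hGm
  have hA' : volume A ≠ ⊤ := measure_ne_top_of_subset sdiff_subset hF'
  refine le_of_forall_pos_le_add fun ε hε => ?_
  obtain ⟨K, hKA, hK, hKv⟩ := hAm.exists_isCompact_sdiff_lt hA' (ε := ENNReal.ofReal (ε / 2))
    (by simpa using hε)
  obtain ⟨U, hAU, hU, hU', hUv⟩ := hAm.exists_isOpen_sdiff_lt hA' (ε := ENNReal.ofReal (ε / 2))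
    (by simpa using hε)
  obtain ⟨ψ, hψ1, hψ2, hψ3, hψK, hψU⟩ := exists_contDiff_bump hK hU (hKA.trans hAU)
  have hint : Integrable ψ := hψ1.continuous.integrable_of_hasCompactSupport hψ2
  have hmain := integral_sub_translate_le hF' hP hψ1 hψ2
    (fun x => abs_le.2 ⟨by linarith [(hψ3 x).1], (hψ3 x).2⟩) v
  have e1 : ∫ x in F, ψ (x - v) = ∫ x in G, ψ x := by
    have := hmp.setIntegral_preimage_emb (measurableEmbedding_addRight v) (fun x => ψ (x - v)) F
    simpa using this.symm
  rw [integral_sub hint.integrableOn (by exact (hint.comp_sub_right v).integrableOn), e1,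
    ← integral_indicator hF, ← integral_indicator hGm,
    ← integral_sub (hint.indicator hF) (hint.indicator hGm)] at hmain
  have hUA : volume (U \ A) ≠ ⊤ := hUv.ne_top
  have hKm := hK.measurableSet
  have hUAm : MeasurableSet (U \ A) := hU.measurableSet.diff hAm
  -- Pointwise, `1_F ψ - 1_G ψ ≥ 1_K - 1_{U \ A}`: on `A` the left side is `ψ`, and elsewhere it is
  -- at least `-ψ`, which vanishes off `U`.
  have hlow : volume.real K - volume.real (U \ A) ≤
      ∫ x, (F.indicator ψ x - G.indicator ψ x) := by
    have i1 : Integrable (K.indicator (fun _ => (1 : ℝ))) :=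
      (integrable_indicator_iff hKm).2 (integrableOn_const hK.measure_ne_top)
    have i2 : Integrable ((U \ A).indicator (fun _ => (1 : ℝ))) :=
      (integrable_indicator_iff hUAm).2 (integrableOn_const hUA)
    have : volume.real K - volume.real (U \ A) =
        ∫ x, (K.indicator (fun _ => (1 : ℝ)) x - (U \ A).indicator (fun _ => (1 : ℝ)) x) := by
      rw [integral_sub i1 i2, integral_indicator hKm, integral_indicator hUAm]
      simp
    rw [this]
    refine integral_mono (i1.sub i2) ((hint.indicator hF).sub (hint.indicator hGm)) fun x => ?_
    by_cases hxA : x ∈ A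
    · have hxK : K.indicator (fun _ => (1 : ℝ)) x ≤ ψ x := by
        by_cases hx : x ∈ K
        · simp [hx, hψK x hx]
        · simpa [hx] using (hψ3 x).1
      have hxU : x ∉ U \ A := fun h => h.2 hxA
      simpa [hxA.1, hxA.2, hxU] using hxK
    · have hxK : x ∉ K := fun h => hxA (hKA h)
      have hxU : ψ x ≤ (U \ A).indicator (fun _ => (1 : ℝ)) x := by
        by_cases hx : x ∈ U
        · have : x ∈ U \ A := ⟨hx, hxA⟩
          simpa [this] using (hψ3 x).2
        · simpa [hψU x hx] using indicator_nonneg (fun _ _ => zero_le_one) x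
      have h0 : 0 ≤ F.indicator ψ x := indicator_nonneg (fun x _ => (hψ3 x).1) x
      have hG1 : G.indicator ψ x ≤ ψ x := indicator_le_self' (fun x _ => (hψ3 x).1) x
      simp only [hxK, not_false_eq_true, indicator_of_notMem]
      by_cases hxF : x ∈ F
      · have hxG : x ∈ G := by by_contra h; exact hxA ⟨hxF, h⟩
        simp only [hxF, hxG, indicator_of_mem, sub_self, zero_sub, Left.neg_nonpos_iff]
        linarith [(hψ3 x).1]
      · linarith
  have hKr : volume.real A - volume.real K ≤ ε / 2 := by
    rw [← measureReal_sdiff hKA hKm hA']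
    exact ENNReal.toReal_le_of_le_ofReal (by positivity) hKv.le
  have hUr : volume.real (U \ A) ≤ ε / 2 :=
    ENNReal.toReal_le_of_le_ofReal (by positivity) hUv.le
  linarith

/-- Sets of finite perimeter move little in `L¹` under translations. -/
lemma volume_sdiff_translate_le {F : Set Plane} (hF : MeasurableSet F) (hF' : volume F ≠ ⊤)
    (v : Plane) :
    volume (F \ (fun x => x + v) ⁻¹' F) ≤ ENNReal.ofReal ‖v‖ * perimeter F := by
  by_cases hv : v = 0
  · simp [hv]
  by_cases hP : perimeter F = ⊤
  · rw [hP, ENNReal.mul_top (by simpa using hv)]; exact le_top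
  have h := volume_real_sdiff_translate_le hF hF' hP v
  rw [← ENNReal.ofReal_toReal hP, ← ENNReal.ofReal_mul (norm_nonneg v)]
  exact (ENNReal.le_ofReal_iff_toReal_le (measure_ne_top_of_subset sdiff_subset hF')
    (by positivity)).2 h

lemma perimeter_translate_le (F : Set Plane) (a : Plane) :
    perimeter ((fun x => x + a) ⁻¹' F) ≤ perimeter F := by
  refine iSup₂_le fun φ ⟨h1, h2, h3⟩ => ?_
  have hmp : MeasurePreserving (fun x : Plane => x + a) := measurePreserving_add_right volume a
  have := ofReal_integral_divergence_le F (φ := fun x => φ (x - a)) (by fun_prop)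
    (h2.comp_homeomorph (Homeomorph.subRight a)) (fun x => h3 _)
  refine le_trans (le_of_eq ?_) this
  congr 1
  rw [← hmp.setIntegral_preimage_emb (measurableEmbedding_addRight a)
    (fun x => divergence (fun x => φ (x - a)) x) F]
  simp [divergence, fderiv_comp_sub]

lemma perimeter_translate (F : Set Plane) (a : Plane) :
    perimeter ((fun x => x + a) ⁻¹' F) = perimeter F := by
  refine (perimeter_translate_le F a).antisymm ?_
  have := perimeter_translate_le ((fun x => x + a) ⁻¹' F) (-a)
  simpa [preimage_preimage] using this

/-! ### Projections and the diameter of connected sets -/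

/-- To the right of a point `a` of `S`, shifting left by `h` pushes out the interval `(a, a + h]`,
which is filled by `S` when `h` is small. The shifted set thus has measure smaller by `h` on `(a,
∞)`; finiteness allows the subtraction. -/
lemma exists_ofReal_le_volume_sdiff_translate {S : Set ℝ} (hS : IsOpen S) (hne : S.Nonempty)
    (hfin : volume S ≠ ⊤) :
    ∃ δ > 0, ∀ h : ℝ, 0 < h → h < δ →
      ENNReal.ofReal h ≤ volume (S \ (fun s => s + h) ⁻¹' S) := by
  obtain ⟨a, ha⟩ := hne
  obtain ⟨δ, hδ, hball⟩ := Metric.isOpen_iff.1 hS a ha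
  refine ⟨δ, hδ, fun h h0 hlt => ?_⟩
  have hsub : Ioc a (a + h) ⊆ S := fun s hs => hball (by
    rw [Metric.mem_ball, Real.dist_eq, abs_of_pos (by linarith [hs.1])]; linarith [hs.2])
  have e1 : volume (S ∩ Ioi a) = ENNReal.ofReal h + volume (S ∩ Ioi (a + h)) := by
    rw [← Ioc_union_Ioi_eq_Ioi (show a ≤ a + h by linarith), inter_union_distrib_left,
      measure_union _ (hS.measurableSet.inter measurableSet_Ioi), inter_eq_right.2 hsub]
    · simp
    · exact Disjoint.mono inter_subset_right inter_subset_right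
        (Set.disjoint_left.2 fun x hx hx' => not_lt.2 hx.2 hx')
  have e2 : volume (((fun s => s + h) ⁻¹' S) ∩ Ioi a) = volume (S ∩ Ioi (a + h)) := by
    rw [← (measurePreserving_add_right volume h).measure_preimage
      (hS.measurableSet.inter measurableSet_Ioi).nullMeasurableSet]
    congr 1; ext x; simp
  have e3 : volume (S ∩ Ioi a) ≤
      volume (((fun s => s + h) ⁻¹' S) ∩ Ioi a) + volume (S \ (fun s => s + h) ⁻¹' S) := by
    refine (measure_mono ?_).trans (measure_union_le _ _)
    intro x hx
    by_cases hx' : x + h ∈ S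
    · exact Or.inl ⟨hx', hx.2⟩
    · exact Or.inr ⟨hx.1, hx'⟩
  rw [e1, e2, add_comm] at e3
  exact (ENNReal.add_le_add_iff_left (measure_ne_top_of_subset inter_subset_left hfin)).1 e3

/-- The projection of an open set of finite measure along a coordinate direction is not longer
than its perimeter. The map `T` parametrizes the plane by orthonormal coordinates. -/
lemma volume_projection_le_perimeter {F : Set Plane} (hF : IsOpen F) (hfin : volume F ≠ ⊤)
    {T : ℝ × ℝ → Plane} (hT : Continuous T) (hTm : MeasurePreserving T) {w : Plane}
    (hw : ‖w‖ = 1) (hTw : ∀ t s h, T (t, s + h) = T (t, s) + h • w) :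
    volume {t | ∃ s, T (t, s) ∈ F} ≤ perimeter F := by
  set G := T ⁻¹' F with hG
  have hGo : IsOpen G := hF.preimage hT
  have hGfin : volume G ≠ ⊤ := by rwa [hTm.measure_preimage hF.measurableSet.nullMeasurableSet]
  have hI : IsOpen {t | ∃ s, T (t, s) ∈ F} := by
    convert isOpenMap_fst _ hGo using 1
    ext t; simp [hG]
  set h : ℕ → ℝ := fun n => 1 / ((n : ℝ) + 1) with hh
  have h0 : ∀ n, 0 < h n := fun n => Nat.one_div_pos_of_nat
  have hlim : Tendsto h atTop (𝓝 0) := tendsto_one_div_add_atTop_nhds_zero_nat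
  let D : ℕ → Set (ℝ × ℝ) := fun n => T ⁻¹' (F \ (fun x => x + h n • w) ⁻¹' F)
  have hDm : ∀ n, MeasurableSet (D n) := fun n =>
    hT.measurable (hF.measurableSet.diff ((measurable_add_const _) hF.measurableSet))
  let f : ℕ → ℝ → ℝ≥0∞ := fun n t => (ENNReal.ofReal (h n))⁻¹ * volume (Prod.mk t ⁻¹' D n)
  have hf : ∀ n, Measurable (f n) := fun n =>
    (measurable_measure_prodMk_left (hDm n)).const_mul _
  have hint : ∀ n, ∫⁻ t, f n t ≤ perimeter F := by
    intro n
    rw [lintegral_const_mul _ (measurable_measure_prodMk_left (hDm n)),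
      ← Measure.prod_apply (hDm n), ← Measure.volume_eq_prod,
      hTm.measure_preimage (hF.measurableSet.diff
        ((measurable_add_const _) hF.measurableSet)).nullMeasurableSet]
    have := volume_sdiff_translate_le hF.measurableSet hfin (h n • w)
    rw [norm_smul, hw, mul_one, Real.norm_of_nonneg (h0 n).le] at this
    rw [mul_comm, ← div_eq_mul_inv]
    exact ENNReal.div_le_of_le_mul (by rwa [mul_comm])
  -- Almost every slice has finite measure, and a nonempty open one loses at least `h` under a small
  -- shift by `h`, so its difference quotient is eventually at least `1`. Fatou's lemma then
  -- transfers this to the integral bound `hint`.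
  have hae : ∀ᵐ t, ({t | ∃ s, T (t, s) ∈ F}.indicator (fun _ => (1 : ℝ≥0∞)) t) ≤
      liminf (fun n => f n t) atTop := by
    have := Measure.ae_measure_lt_top (μ := (volume : Measure ℝ)) (ν := (volume : Measure ℝ))
      hGo.measurableSet hGfin
    filter_upwards [this] with t ht
    by_cases hmem : ∃ s, T (t, s) ∈ F
    · rw [indicator_of_mem (by exact hmem)]
      have hSo : IsOpen (Prod.mk t ⁻¹' G) := hGo.preimage (by fun_prop)
      obtain ⟨δ, hδ, hδ'⟩ := exists_ofReal_le_volume_sdiff_translate hSo hmem ht.ne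
      refine le_liminf_of_le (by isBoundedDefault) ?_
      filter_upwards [hlim.eventually (gt_mem_nhds hδ)] with n hn
      have h1 := hδ' (h n) (h0 n) hn
      have h2 : Prod.mk t ⁻¹' D n =
          (Prod.mk t ⁻¹' G) \ (fun s => s + h n) ⁻¹' (Prod.mk t ⁻¹' G) := by
        ext s; simp [D, hG, hTw]
      simp only [f]
      rw [h2, mul_comm, ← div_eq_mul_inv, ENNReal.le_div_iff_mul_le (by simp [h0]) (by simp),
        one_mul]
      exact h1
    · rw [indicator_of_notMem (by exact hmem)]; exact zero_le
  calc volume {t | ∃ s, T (t, s) ∈ F}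
      = ∫⁻ t, {t | ∃ s, T (t, s) ∈ F}.indicator (fun _ => (1 : ℝ≥0∞)) t := by
        rw [lintegral_indicator hI.measurableSet]; simp
    _ ≤ ∫⁻ t, liminf (fun n => f n t) atTop := lintegral_mono_ae hae
    _ ≤ liminf (fun n => ∫⁻ t, f n t) atTop := lintegral_liminf_le hf
    _ ≤ perimeter F := liminf_le_of_le (by isBoundedDefault) fun b hb => by
        obtain ⟨n, hn⟩ := hb.exists
        exact hn.trans (hint n)

lemma ofReal_abs_coord_sub_le {F : Set Plane} (hF : IsOpen F) (hc : IsConnected F)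
    (hfin : volume F ≠ ⊤) {x y : Plane} (hx : x ∈ F) (hy : y ∈ F) (i : Fin 2) :
    ENNReal.ofReal |x i - y i| ≤ perimeter F := by
  have key : ∃ (T : ℝ × ℝ → Plane) (w : Plane), Continuous T ∧ MeasurePreserving T ∧ ‖w‖ = 1 ∧
      (∀ t s h, T (t, s + h) = T (t, s) + h • w) ∧ ∀ z : Plane, ∃ s, T (z i, s) = z := by
    have hmp : MeasurePreserving (fun p : ℝ × ℝ => (WithLp.toLp 2 ![p.1, p.2] : Plane)) :=
      (PiLp.volume_preserving_toLp (Fin 2)).comp ((volume_preserving_finTwoArrow ℝ).symm _)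
    have hco : Continuous (fun p : ℝ × ℝ => (WithLp.toLp 2 ![p.1, p.2] : Plane)) := by fun_prop
    fin_cases i
    · refine ⟨_, EuclideanSpace.single 1 1, hco, hmp, by simp, fun t s h => ?_,
        fun z => ⟨z 1, ?_⟩⟩
      · ext j; fin_cases j <;> simp
      · ext j; fin_cases j <;> simp
    · refine ⟨fun p => WithLp.toLp 2 ![p.2, p.1], EuclideanSpace.single 0 1, by fun_prop,
        hmp.comp (Measure.measurePreserving_swap), by simp, fun t s h => ?_, fun z => ⟨z 0, ?_⟩⟩
      · ext j; fin_cases j <;> simp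
      · ext j; fin_cases j <;> simp
  obtain ⟨T, w, hT, hTm, hw, hTw, hTs⟩ := key
  refine le_trans ?_ (volume_projection_le_perimeter hF hfin hT hTm hw hTw)
  have hsub : (fun z : Plane => z i) '' F ⊆ {t | ∃ s, T (t, s) ∈ F} := by
    rintro _ ⟨z, hz, rfl⟩
    obtain ⟨s, hs⟩ := hTs z
    exact ⟨s, by rwa [hs]⟩
  -- The projection of a connected set is an interval, so it contains everything between the two
  -- coordinates.
  have hord : OrdConnected ((fun z : Plane => z i) '' F) :=
    (hc.isPreconnected.image _ (by fun_prop)).ordConnected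
  have := (hord.uIcc_subset (mem_image_of_mem _ hy) (mem_image_of_mem _ hx)).trans hsub
  refine le_trans ?_ (measure_mono this)
  rw [Real.volume_interval]

lemma norm_sub_le_abs_add_abs (x y : Plane) : ‖x - y‖ ≤ |x 0 - y 0| + |x 1 - y 1| := by
  rw [EuclideanSpace.norm_eq, Fin.sum_univ_two]
  refine Real.sqrt_le_iff.2 ⟨by positivity, ?_⟩
  simp only [PiLp.sub_apply, Real.norm_eq_abs]
  nlinarith [abs_nonneg (x 0 - y 0), abs_nonneg (x 1 - y 1)]

/-- The diameter of a connected open set of finite measure is controlled by its perimeter. -/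
lemma edist_le_two_mul_perimeter {F : Set Plane} (hF : IsOpen F) (hc : IsConnected F)
    (hfin : volume F ≠ ⊤) {x y : Plane} (hx : x ∈ F) (hy : y ∈ F) :
    edist x y ≤ 2 * perimeter F := by
  rw [edist_dist, dist_eq_norm, two_mul]
  refine (ENNReal.ofReal_le_ofReal (norm_sub_le_abs_add_abs x y)).trans ?_
  rw [ENNReal.ofReal_add (abs_nonneg _) (abs_nonneg _)]
  exact add_le_add (ofReal_abs_coord_sub_le hF hc hfin hx hy 0)
    (ofReal_abs_coord_sub_le hF hc hfin hx hy 1)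

/-! ### From smooth approximants to the relaxed perimeter -/

/-- The properties of a class of approximating sets that the existence proof uses. -/
structure IsApproxClass (A : Set Plane → Prop) : Prop where
  isOpen : ∀ {F}, A F → IsOpen F
  isConnected : ∀ {F}, A F → IsConnected F
  translate : ∀ {F}, A F → ∀ a : Plane, A ((fun x => x + a) ⁻¹' F)
  ball : ∀ r : ℝ, 0 < r → A (Metric.ball 0 r)

lemma volume_ne_top_of_symmDiff {E F : Set Plane} (hE : volume E ≠ ⊤)
    (h : volume (symmDiff F E) ≠ ⊤) : volume F ≠ ⊤ := by
  refine ne_top_of_le_ne_top (ENNReal.add_ne_top.2 ⟨h, hE⟩)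
    ((measure_mono ?_).trans (measure_union_le _ _))
  intro x hx
  by_cases hxE : x ∈ E
  · exact Or.inr hxE
  · exact Or.inl (Or.inl ⟨hx, hxE⟩)

lemma inter_nonempty_of_volume_symmDiff_lt {E F B : Set Plane}
    (h : volume (symmDiff F E) < volume (E ∩ B)) : (F ∩ B).Nonempty := by
  by_contra hne
  refine not_le.2 h (measure_mono fun x hx => Or.inr ⟨hx.1, fun hxF => hne ⟨x, hxF, hx.2⟩⟩)

/-- An `L¹`-close approximant must meet any small ball in which `E` has positive measure. Two far
apart points of the essential support therefore force a large diameter, hence a large perimeter, on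
the approximants. -/
lemma essDiam_le {A : Set Plane → Prop} (hA : IsApproxClass A) {E : Set Plane}
    (hE : volume E ≠ ⊤) : essDiam E ≤ 2 * relaxedPerimeter A E := by
  refine Metric.ediam_le fun x hx y hy => ?_
  rw [mem_ofPred_eq] at hx hy
  by_contra! hlt
  have hne : relaxedPerimeter A E ≠ ⊤ := by
    rintro h; rw [h] at hlt; simp at hlt
  have hlt' : relaxedPerimeter A E < edist x y / 2 := by
    rwa [ENNReal.lt_div_iff_mul_lt (by simp) (by simp), mul_comm]
  unfold relaxedPerimeter at hlt'
  simp only [iInf_lt_iff] at hlt'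
  obtain ⟨F, ⟨hF, hFE⟩, hlim⟩ := hlt'
  obtain ⟨c, hc1, hc2⟩ := exists_between hlim
  have hc3 : 2 * c < edist x y := by
    rwa [ENNReal.lt_div_iff_mul_lt (by simp) (by simp), mul_comm] at hc2
  obtain ⟨d, hd1, hd2⟩ := exists_between hc3
  have hdtop : d ≠ ⊤ := hd2.ne_top
  obtain ⟨r, hr, hrd⟩ : ∃ r : ℝ, 0 < r ∧ 2 * c + 2 * ENNReal.ofReal r ≤ d := by
    have h2c : 2 * c ≠ ⊤ := hc3.ne_top
    refine ⟨((d - 2 * c) / 2).toReal, ENNReal.toReal_pos ?_ ?_, ?_⟩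
    · exact (ENNReal.half_pos (tsub_pos_of_lt hd1).ne').ne'
    · exact (ENNReal.div_lt_top (ENNReal.sub_ne_top hdtop) (by simp)).ne
    · rw [ENNReal.ofReal_toReal
        (ENNReal.div_lt_top (ENNReal.sub_ne_top hdtop) (by simp)).ne,
        ENNReal.mul_div_cancel (by simp) (by simp), add_tsub_cancel_of_le hd1.le]
  have hfreq := frequently_lt_of_liminf_lt (by isBoundedDefault) hc1
  have hev := ((hFE.eventually (gt_mem_nhds (hx r hr))).and
    (hFE.eventually (gt_mem_nhds (hy r hr)))).and
    (hFE.eventually (gt_mem_nhds ENNReal.zero_lt_top))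
  obtain ⟨n, hn, ⟨h1, h2⟩, h3⟩ := (hfreq.and_eventually hev).exists
  obtain ⟨x', hx'F, hx'⟩ := inter_nonempty_of_volume_symmDiff_lt h1
  obtain ⟨y', hy'F, hy'⟩ := inter_nonempty_of_volume_symmDiff_lt h2
  have h4 := edist_le_two_mul_perimeter (hA.isOpen (hF n)) (hA.isConnected (hF n))
    (volume_ne_top_of_symmDiff hE h3.ne) hx'F hy'F
  have hxx : edist x x' ≤ ENNReal.ofReal r := by
    rw [edist_comm, edist_dist]; exact ENNReal.ofReal_le_ofReal (Metric.mem_ball.1 hx').le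
  have hyy : edist y' y ≤ ENNReal.ofReal r := by
    rw [edist_dist]; exact ENNReal.ofReal_le_ofReal (Metric.mem_ball.1 hy').le
  have : edist x y ≤ d := calc
    edist x y ≤ edist x x' + edist x' y' + edist y' y := edist_triangle4 _ _ _ _
    _ ≤ ENNReal.ofReal r + 2 * c + ENNReal.ofReal r := by
      gcongr; exact h4.trans (by gcongr)
    _ = 2 * c + 2 * ENNReal.ofReal r := by ring
    _ ≤ d := hrd
  exact not_le.2 hd2 this

/-! ### Compactness in `L¹` by grid approximation -/

/-- The index of the cell of the square grid of side `l` that contains a point. -/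
noncomputable def gridIndex (l : ℝ) (x : Plane) : Fin 2 → ℤ := fun i => ⌊x i / l⌋

lemma measurable_gridIndex (l : ℝ) : Measurable (gridIndex l) :=
  measurable_pi_iff.2 fun i => Int.measurable_floor.comp
    (((EuclideanSpace.proj (𝕜 := ℝ) i).continuous.measurable).div_const l)

lemma gridIndex_eq_iff {l : ℝ} (hl : 0 < l) (x : Plane) (c : Fin 2 → ℤ) :
    gridIndex l x = c ↔ ∀ i, x i ∈ Ico (c i * l) (c i * l + l) := by
  rw [funext_iff]
  refine forall_congr' fun i => ?_
  rw [gridIndex, Int.floor_eq_iff, mem_Ico, le_div_iff₀ hl, div_lt_iff₀ hl, add_mul, one_mul]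

lemma norm_sub_le_of_gridIndex_eq {l : ℝ} (hl : 0 < l) {x y : Plane}
    (h : gridIndex l x = gridIndex l y) : ‖x - y‖ ≤ 2 * l := by
  have hx := (gridIndex_eq_iff hl x _).1 h
  have hy := (gridIndex_eq_iff hl y _).1 rfl
  have hi : ∀ i, |x i - y i| ≤ l := fun i => by
    have h1 := hx i; have h2 := hy i
    rw [mem_Ico] at h1 h2
    exact abs_le.2 ⟨by linarith, by linarith⟩
  linarith [norm_sub_le_abs_add_abs x y, hi 0, hi 1]

lemma volume_gridCell {l : ℝ} (hl : 0 < l) (c : Fin 2 → ℤ) :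
    volume (gridIndex l ⁻¹' {c}) = ENNReal.ofReal l ^ 2 := by
  have : gridIndex l ⁻¹' {c} =
      WithLp.ofLp ⁻¹' (univ.pi fun i : Fin 2 => Ico (c i * l) (c i * l + l)) := by
    ext x
    simp only [mem_preimage, mem_singleton_iff, gridIndex_eq_iff hl, Set.mem_pi, mem_univ,
      true_imp_iff]
  rw [this, (PiLp.volume_preserving_ofLp (Fin 2)).measure_preimage
    (MeasurableSet.univ_pi fun _ => measurableSet_Ico).nullMeasurableSet, Real.volume_pi_Ico]
  simp

lemma lintegral_eq_tsum_gridCell (l : ℝ) (f : Plane → ℝ≥0∞) :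
    ∫⁻ x, f x = ∑' c, ∫⁻ x in gridIndex l ⁻¹' {c}, f x := by
  rw [← lintegral_iUnion (fun c => measurable_gridIndex l (measurableSet_singleton c))
    (fun c d hcd => Set.disjoint_left.2 fun x hx hx' => hcd (hx.symm.trans hx'))]
  rw [← preimage_iUnion, iUnion_of_singleton, preimage_univ, setLIntegral_univ]

/-- Integrated translation estimate. -/
lemma lintegral_volume_closedBall_sdiff_le {F : Set Plane} (hF : MeasurableSet F)
    (hfin : volume F ≠ ⊤) (r : ℝ) :
    ∫⁻ x in F, volume (Metric.closedBall x r \ F) ≤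
      volume (Metric.closedBall (0 : Plane) r) * (ENNReal.ofReal r * perimeter F) := by
  set B := Metric.closedBall (0 : Plane) r with hB
  have hBm : MeasurableSet B := Metric.isClosed_closedBall.measurableSet
  have hm : Measurable (fun p : Plane × Plane => Fᶜ.indicator (1 : Plane → ℝ≥0∞) (p.1 + p.2)) :=
    (measurable_one.indicator hF.compl).comp (measurable_fst.add measurable_snd)
  have h1 : ∀ x, volume (Metric.closedBall x r \ F) =
      ∫⁻ v in B, Fᶜ.indicator (1 : Plane → ℝ≥0∞) (x + v) := by
    intro x
    have hmeas : MeasurableSet (Metric.closedBall x r \ F) :=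
      Metric.isClosed_closedBall.measurableSet.diff hF
    rw [← (measurePreserving_add_left volume x).measure_preimage hmeas.nullMeasurableSet,
      ← lintegral_indicator_one ((measurable_const_add x) hmeas), ← lintegral_indicator hBm]
    congr 1
    ext v
    by_cases hv : v ∈ B <;> by_cases hv' : x + v ∈ F <;>
      simp_all [indicator, dist_eq_norm]
  simp_rw [h1]
  rw [lintegral_lintegral_swap (by exact hm.aemeasurable)]
  have h2 : ∀ v ∈ B, ∫⁻ x in F, Fᶜ.indicator (1 : Plane → ℝ≥0∞) (x + v) ≤
      ENNReal.ofReal r * perimeter F := by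
    intro v hv
    have hmeas : MeasurableSet ((fun x => x + v) ⁻¹' Fᶜ) := (measurable_add_const v) hF.compl
    have : ∫⁻ x in F, Fᶜ.indicator (1 : Plane → ℝ≥0∞) (x + v) =
        volume (F \ (fun x => x + v) ⁻¹' F) := by
      have e : (fun x => Fᶜ.indicator (1 : Plane → ℝ≥0∞) (x + v)) =
          ((fun x => x + v) ⁻¹' Fᶜ).indicator 1 := by
        ext x
        by_cases h : x + v ∈ F <;> simp [h]
      rw [e, lintegral_indicator_one hmeas, Measure.restrict_apply hmeas]
      congr 1
      ext x; simp [and_comm]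
    rw [this]
    refine (volume_sdiff_translate_le hF hfin v).trans ?_
    gcongr
    simpa [hB] using hv
  calc _ ≤ ∫⁻ v in B, ENNReal.ofReal r * perimeter F := setLIntegral_mono measurable_const h2
    _ = _ := by rw [setLIntegral_const, mul_comm]

/-- The union of the grid cells that are filled by `F` to more than one half. -/
noncomputable def gridApprox (l : ℝ) (F : Set Plane) : Set Plane :=
  gridIndex l ⁻¹' {c | ENNReal.ofReal l ^ 2 < 2 * volume (F ∩ gridIndex l ⁻¹' {c})}

lemma measurableSet_gridApprox (l : ℝ) (F : Set Plane) : MeasurableSet (gridApprox l F) :=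
  measurable_gridIndex l (Set.to_countable _).measurableSet

lemma mem_gridApprox {l : ℝ} {F : Set Plane} {x : Plane} : x ∈ gridApprox l F ↔
    ENNReal.ofReal l ^ 2 < 2 * volume (F ∩ gridIndex l ⁻¹' {gridIndex l x}) := Iff.rfl

/-- The error in a cell is the smaller of the parts inside and outside `F`, while the larger one
fills at least half of the cell. -/
lemma mul_volume_symmDiff_gridApprox_inter_le {F : Set Plane} (hF : MeasurableSet F) {l : ℝ}
    (hl : 0 < l) (c : Fin 2 → ℤ) :
    ENNReal.ofReal l ^ 2 * volume (symmDiff F (gridApprox l F) ∩ gridIndex l ⁻¹' {c}) ≤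
      2 * (volume (F ∩ gridIndex l ⁻¹' {c}) * volume (gridIndex l ⁻¹' {c} \ F)) := by
  set Q := gridIndex l ⁻¹' {c} with hQ
  have hQv : volume Q = ENNReal.ofReal l ^ 2 := volume_gridCell hl c
  by_cases h : ENNReal.ofReal l ^ 2 < 2 * volume (F ∩ Q)
  · have hsub : symmDiff F (gridApprox l F) ∩ Q ⊆ Q \ F := by
      rintro x ⟨hx, hxQ⟩
      have hxc : gridIndex l x = c := hxQ
      have hxU : x ∈ gridApprox l F := by
        rw [mem_gridApprox, hxc]; exact h
      exact ⟨hxQ, fun hxF => hx.elim (fun h => h.2 hxU) fun h => h.2 hxF⟩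
    rw [← mul_assoc]
    exact mul_le_mul' h.le (measure_mono hsub)
  · have hsub : symmDiff F (gridApprox l F) ∩ Q ⊆ F ∩ Q := by
      rintro x ⟨hx, hxQ⟩
      have hxc : gridIndex l x = c := hxQ
      have hxU : x ∉ gridApprox l F := by
        intro hx
        rw [mem_gridApprox, hxc] at hx; exact h hx
      exact ⟨hx.elim (fun h => h.1) fun h => absurd h.1 hxU, hxQ⟩
    have h2 : ENNReal.ofReal l ^ 2 ≤ 2 * volume (Q \ F) := by
      have hsum : volume (F ∩ Q) + volume (Q \ F) = ENNReal.ofReal l ^ 2 := by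
        rw [inter_comm, measure_inter_add_sdiff Q hF, hQv]
      have hfin : volume (F ∩ Q) ≠ ⊤ :=
        measure_ne_top_of_subset inter_subset_right (by rw [hQv]; finiteness)
      rw [not_lt] at h
      have h3 : volume (F ∩ Q) ≤ volume (Q \ F) := by
        rw [← hsum, two_mul] at h
        exact (ENNReal.add_le_add_iff_left hfin).1 h
      rw [← hsum, two_mul]
      gcongr
    calc _ ≤ 2 * volume (Q \ F) * volume (F ∩ Q) := mul_le_mul' h2 (measure_mono hsub)
      _ = _ := by ring

/-- Sets of finite perimeter are approximated by unions of grid cells. -/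
lemma volume_symmDiff_gridApprox_le {F : Set Plane} (hF : MeasurableSet F)
    (hfin : volume F ≠ ⊤) {l : ℝ} (hl : 0 < l) :
    volume (symmDiff F (gridApprox l F)) ≤
      4 * volume (Metric.closedBall (0 : Plane) 2) * perimeter F * ENNReal.ofReal l := by
  set D := symmDiff F (gridApprox l F) with hD
  have hDm : MeasurableSet D := hF.symmDiff (measurableSet_gridApprox l F)
  have hQm : ∀ c, MeasurableSet (gridIndex l ⁻¹' {c}) := fun c =>
    measurable_gridIndex l (measurableSet_singleton c)
  have h1 : ENNReal.ofReal l ^ 2 * volume D ≤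
      2 * ∫⁻ x in F, volume (Metric.closedBall x (2 * l) \ F) := by
    calc ENNReal.ofReal l ^ 2 * volume D
        = ∑' c, ENNReal.ofReal l ^ 2 * volume (D ∩ gridIndex l ⁻¹' {c}) := by
          rw [ENNReal.tsum_mul_left, ← lintegral_indicator_one hDm, lintegral_eq_tsum_gridCell l]
          simp_rw [lintegral_indicator_one hDm, Measure.restrict_apply hDm]
      _ ≤ ∑' c, 2 * (volume (F ∩ gridIndex l ⁻¹' {c}) * volume (gridIndex l ⁻¹' {c} \ F)) :=
          ENNReal.tsum_le_tsum fun c => mul_volume_symmDiff_gridApprox_inter_le hF hl c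
      -- A cell lies in the ball of radius `2 * l` around each of its points, so the products sum to
      -- a double integral that averages translations of `F`.
      _ ≤ 2 * ∑' c, ∫⁻ x in gridIndex l ⁻¹' {c},
            F.indicator (fun x => volume (Metric.closedBall x (2 * l) \ F)) x := by
          rw [ENNReal.tsum_mul_left]
          gcongr with c
          rw [setLIntegral_indicator hF]
          rw [mul_comm, ← setLIntegral_const]
          refine setLIntegral_mono' (hF.inter (hQm c)) fun x hx => measure_mono ?_
          refine sdiff_subset_sdiff_left fun y hy => ?_
          rw [Metric.mem_closedBall, dist_eq_norm]
          exact norm_sub_le_of_gridIndex_eq hl (Eq.trans hy (Eq.symm hx.2))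
      _ = _ := by rw [← lintegral_eq_tsum_gridCell, lintegral_indicator hF]
  have h2 := h1.trans (mul_le_mul_right (lintegral_volume_closedBall_sdiff_le hF hfin (2 * l)) 2)
  have h3 : volume (Metric.closedBall (0 : Plane) (2 * l)) =
      ENNReal.ofReal l ^ 2 * volume (Metric.closedBall (0 : Plane) 2) := by
    rw [mul_comm 2 l, Measure.addHaar_closedBall_mul_of_pos _ _ hl]
    simp [ENNReal.ofReal_pow hl.le]
  rw [h3, ENNReal.ofReal_mul zero_le_two, ENNReal.ofReal_ofNat] at h2
  have hl0 : ENNReal.ofReal l ^ 2 ≠ 0 := by simpa using hl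
  refine (ENNReal.mul_le_mul_iff_right hl0 (by finiteness)).1 (h2.trans (le_of_eq ?_))
  ring

/-- Only finitely many cells meet the ball, so the unions of such cells form a finite net; the grid
error is at most `K * l`, which fixes the choice of `l`. -/
lemma totallyBounded_setOf_perimeter_le (R : ℝ) {M : ℝ≥0∞} (hM : M ≠ ⊤) :
    TotallyBounded {F : MeasuredSets (volume : Measure Plane) |
      (F : Set Plane) ⊆ Metric.closedBall 0 R ∧ perimeter (F : Set Plane) ≤ M} := by
  rw [EMetric.totallyBounded_iff]
  intro ε hε
  set K := 4 * volume (Metric.closedBall (0 : Plane) 2) * M with hK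
  have hKtop : K ≠ ⊤ := ENNReal.mul_ne_top
    (ENNReal.mul_ne_top (by simp) (isCompact_closedBall _ _).measure_ne_top) hM
  obtain ⟨l, hl, hlε⟩ : ∃ l : ℝ, 0 < l ∧ K * ENNReal.ofReal l < ε := by
    have : Tendsto (fun l : ℝ => K * ENNReal.ofReal l) (𝓝[>] 0) (𝓝 (K * ENNReal.ofReal 0)) :=
      (ENNReal.Tendsto.const_mul (ENNReal.continuous_ofReal.tendsto 0) (Or.inr hKtop)).mono_left
        nhdsWithin_le_nhds
    rw [ENNReal.ofReal_zero, mul_zero] at this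
    have hev := (this.eventually (gt_mem_nhds hε)).and self_mem_nhdsWithin
    obtain ⟨l, hl1, hl2⟩ := hev.exists
    exact ⟨l, hl2, hl1⟩
  let C : Set (Fin 2 → ℤ) := Icc (fun _ => ⌊-R / l⌋) (fun _ => ⌊R / l⌋)
  have hC : C.Finite := Set.finite_Icc _ _
  let Φ : Set (Fin 2 → ℤ) → MeasuredSets (volume : Measure Plane) := fun S =>
    ⟨gridIndex l ⁻¹' S, measurable_gridIndex l (Set.to_countable _).measurableSet⟩
  refine ⟨Φ '' (𝒫 C), hC.powerset.image _, ?_⟩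
  rintro F ⟨hFR, hFM⟩
  have hfin : volume (F : Set Plane) ≠ ⊤ :=
    measure_ne_top_of_subset hFR (isCompact_closedBall _ _).measure_ne_top
  refine mem_iUnion₂.2 ⟨Φ {c | ENNReal.ofReal l ^ 2 <
    2 * volume ((F : Set Plane) ∩ gridIndex l ⁻¹' {c})}, mem_image_of_mem _ ?_, ?_⟩
  · intro c hc
    have hne : ((F : Set Plane) ∩ gridIndex l ⁻¹' {c}).Nonempty := by
      refine nonempty_of_measure_ne_zero (μ := volume) fun h0 => ?_
      rw [mem_ofPred_eq, h0] at hc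
      simp at hc
    obtain ⟨x, hxF, hxc⟩ := hne
    have hxc' : gridIndex l x = c := hxc
    have hxR : ‖x‖ ≤ R := by simpa using hFR hxF
    rw [← hxc']
    have hi : ∀ i, |x i| ≤ R := fun i => (PiLp.norm_apply_le x i).trans hxR
    exact ⟨fun i => Int.floor_le_floor (by gcongr; exact (abs_le.1 (hi i)).1),
      fun i => Int.floor_le_floor (by gcongr; exact (abs_le.1 (hi i)).2)⟩
  · rw [Metric.mem_eball, MeasuredSets.edist_def]
    refine lt_of_le_of_lt ((volume_symmDiff_gridApprox_le F.2 hfin hl).trans ?_) hlε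
    rw [hK]
    gcongr
    exact hFM

/-- Along a rapidly Cauchy sequence, the set-theoretic `liminf` is the limit: a point where `u N`
and the `liminf` disagree must lie in some later consecutive difference, and these have summable
measures. -/
instance completeSpace_measuredSets {α : Type*} [MeasurableSpace α] (μ : Measure α) :
    CompleteSpace (MeasuredSets μ) := by
  refine EMetric.complete_of_convergent_controlled_sequences (fun n => (2⁻¹ : ℝ≥0∞) ^ n)
    (fun n => ENNReal.pow_pos (by simp) n) fun u hu => ?_
  let L : MeasuredSets μ := ⟨liminf (fun n => (u n : Set α)) atTop,
    MeasurableSet.measurableSet_liminf fun n => (u n).2⟩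
  refine ⟨L, tendsto_iff_edist_tendsto_0.2 ?_⟩
  have hb : ∀ N, edist (u N) L ≤ 2 * (2⁻¹ : ℝ≥0∞) ^ N := by
    intro N
    have hsub : symmDiff (u N : Set α) L ⊆
        ⋃ n : ℕ, symmDiff (u (N + n) : Set α) (u (N + (n + 1))) := by
      intro x hx
      by_contra hx'
      simp only [mem_iUnion, not_exists] at hx'
      have hst : ∀ n, x ∈ (u (N + n) : Set α) ↔ x ∈ (u N : Set α) := by
        intro n
        induction n with
        | zero => simp
        | succ n ih =>
          rw [← ih]
          have := hx' n
          rw [mem_symmDiff] at this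
          tauto
      have hL : x ∈ (L : Set α) ↔ x ∈ (u N : Set α) := by
        change x ∈ liminf (fun n => (u n : Set α)) atTop ↔ _
        rw [mem_liminf_iff_eventually_mem]
        constructor
        · intro h
          obtain ⟨n, hn, hN⟩ := (h.and (eventually_ge_atTop N)).exists
          obtain ⟨k, rfl⟩ := Nat.exists_eq_add_of_le hN
          exact (hst k).1 hn
        · intro h
          filter_upwards [eventually_ge_atTop N] with n hn
          obtain ⟨k, rfl⟩ := Nat.exists_eq_add_of_le hn
          exact (hst k).2 h
      rw [mem_symmDiff] at hx
      tauto
    calc edist (u N) L ≤ ∑' n : ℕ, μ (symmDiff (u (N + n) : Set α) (u (N + (n + 1)))) :=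
          (measure_mono hsub).trans (measure_iUnion_le _)
      _ ≤ ∑' n : ℕ, (2⁻¹ : ℝ≥0∞) ^ (N + n) :=
          ENNReal.tsum_le_tsum fun n => (hu (N + n) (N + n) (N + (n + 1)) le_rfl (by omega)).le
      _ = 2 * (2⁻¹ : ℝ≥0∞) ^ N := by
          simp_rw [pow_add]
          rw [ENNReal.tsum_mul_left, ENNReal.tsum_geometric, ENNReal.one_sub_inv_two, inv_inv,
            mul_comm]
  refine tendsto_of_tendsto_of_tendsto_of_le_of_le tendsto_const_nhds ?_ (fun _ => zero_le) hb
  have := ENNReal.Tendsto.const_mul (a := 2)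
    (ENNReal.tendsto_pow_atTop_nhds_zero_of_lt_one (r := 2⁻¹) (by simp)) (Or.inr (by simp))
  simpa using this

/-- Compactness of sets of bounded perimeter in a fixed ball. -/
lemma exists_subseq_tendsto_volume_symmDiff {F : ℕ → Set Plane} (hF : ∀ n, MeasurableSet (F n))
    {R : ℝ} (hR : ∀ n, F n ⊆ Metric.closedBall 0 R) {M : ℝ≥0∞} (hM : M ≠ ⊤)
    (hP : ∀ n, perimeter (F n) ≤ M) :
    ∃ E, MeasurableSet E ∧ ∃ φ : ℕ → ℕ, StrictMono φ ∧
      Tendsto (fun n => volume (symmDiff (F (φ n)) E)) atTop (𝓝 0) := by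
  let u : ℕ → MeasuredSets (volume : Measure Plane) := fun n => ⟨F n, hF n⟩
  have hc := (totallyBounded_setOf_perimeter_le R hM).closure.isCompact_of_isClosed
    isClosed_closure
  obtain ⟨E, -, φ, hφ, hlim⟩ := hc.tendsto_subseq
    (x := u)
    (fun n => subset_closure ⟨hR n, hP n⟩)
  exact ⟨E.1, E.2, φ, hφ, tendsto_iff_edist_tendsto_0.1 hlim⟩

/-! ### Continuity and bounds for the logarithmic interaction -/

/-- The self-interaction of a set with respect to a nonnegative convolution kernel. -/
noncomputable def kernelEnergy (k : Plane → ℝ≥0∞) (E : Set Plane) : ℝ≥0∞ :=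
  ∫⁻ x in E, ∫⁻ y in E, k (x - y)

lemma kernelEnergy_translate (k : Plane → ℝ≥0∞) (E : Set Plane) (a : Plane) :
    kernelEnergy k ((fun x => x + a) ⁻¹' E) = kernelEnergy k E := by
  have hmp : MeasurePreserving (fun x : Plane => x + a) := measurePreserving_add_right volume a
  have hemb := measurableEmbedding_addRight a
  unfold kernelEnergy
  rw [← hmp.setLIntegral_comp_preimage_emb hemb (fun x => ∫⁻ y in E, k (x - y)) E]
  refine lintegral_congr fun x => ?_
  rw [← hmp.setLIntegral_comp_preimage_emb hemb (fun y => k (x + a - y)) E]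
  simp

lemma kernelEnergy_le_lintegral_mul (k : Plane → ℝ≥0∞) (E : Set Plane) :
    kernelEnergy k E ≤ (∫⁻ z, k z) * volume E := by
  refine (lintegral_mono fun x => ?_).trans_eq (setLIntegral_const E _)
  exact (setLIntegral_le_lintegral _ _).trans_eq (lintegral_sub_left_eq_self k x)

/-- The interaction is Lipschitz with respect to the `L¹` distance. -/
lemma kernelEnergy_le_add {k : Plane → ℝ≥0∞} (hk : Measurable k) (E F : Set Plane) :
    kernelEnergy k E ≤ kernelEnergy k F + 2 * ((∫⁻ z, k z) * volume (E \ F)) := by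
  have hE : E ⊆ F ∪ E \ F := by intro x hx; by_cases h : x ∈ F <;> simp [h, hx]
  have hm : Measurable (fun p : Plane × Plane => k (p.1 - p.2)) :=
    hk.comp (measurable_fst.sub measurable_snd)
  have h1 : kernelEnergy k E ≤
      (∫⁻ x in F, ∫⁻ y in E, k (x - y)) + ∫⁻ x in E \ F, ∫⁻ y in E, k (x - y) :=
    (lintegral_mono_set hE).trans (lintegral_union_le _ _ _)
  have h2 : ∫⁻ x in E \ F, ∫⁻ y in E, k (x - y) ≤ (∫⁻ z, k z) * volume (E \ F) := by
    refine (lintegral_mono fun x => ?_).trans_eq (setLIntegral_const _ _)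
    exact (setLIntegral_le_lintegral _ _).trans_eq (lintegral_sub_left_eq_self k x)
  have h3 : ∫⁻ x in F, ∫⁻ y in E, k (x - y) ≤
      kernelEnergy k F + ∫⁻ x in F, ∫⁻ y in E \ F, k (x - y) := by
    unfold kernelEnergy
    rw [← lintegral_add_left hm.lintegral_prod_right']
    exact lintegral_mono fun x => (lintegral_mono_set hE).trans (lintegral_union_le _ _ _)
  have h4 : ∫⁻ x in F, ∫⁻ y in E \ F, k (x - y) ≤ (∫⁻ z, k z) * volume (E \ F) := by
    rw [lintegral_lintegral_swap (by exact hm.aemeasurable)]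
    refine (lintegral_mono fun y => ?_).trans_eq (setLIntegral_const _ _)
    exact (setLIntegral_le_lintegral _ _).trans_eq (lintegral_sub_right_eq_self k y)
  calc _ ≤ _ := h1
    _ ≤ (kernelEnergy k F + (∫⁻ z, k z) * volume (E \ F)) + (∫⁻ z, k z) * volume (E \ F) :=
        add_le_add (h3.trans (by gcongr)) h2
    _ = _ := by ring

lemma tendsto_kernelEnergy {k : Plane → ℝ≥0∞} (hk : Measurable k) (hk' : ∫⁻ z, k z ≠ ⊤)
    {E : ℕ → Set Plane} {F : Set Plane} (hF : volume F ≠ ⊤)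
    (h : Tendsto (fun n => volume (symmDiff (E n) F)) atTop (𝓝 0)) :
    Tendsto (fun n => kernelEnergy k (E n)) atTop (𝓝 (kernelEnergy k F)) := by
  have hfin : kernelEnergy k F ≠ ⊤ :=
    ne_top_of_le_ne_top (ENNReal.mul_ne_top hk' hF) (kernelEnergy_le_lintegral_mul k F)
  have h0 : Tendsto (fun n => 2 * ((∫⁻ z, k z) * volume (symmDiff (E n) F))) atTop (𝓝 0) := by
    simpa using ENNReal.Tendsto.const_mul (a := 2)
      (ENNReal.Tendsto.const_mul (a := ∫⁻ z, k z) h (Or.inr hk')) (Or.inr (by simp))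
  refine tendsto_of_tendsto_of_tendsto_of_le_of_le
    (g := fun n => kernelEnergy k F - 2 * ((∫⁻ z, k z) * volume (symmDiff (E n) F)))
    (h := fun n => kernelEnergy k F + 2 * ((∫⁻ z, k z) * volume (symmDiff (E n) F))) ?_ ?_ ?_ ?_
  · simpa using ENNReal.Tendsto.sub tendsto_const_nhds h0 (Or.inl hfin)
  · simpa using tendsto_const_nhds.add h0
  · intro n
    refine tsub_le_iff_right.2 ((kernelEnergy_le_add hk F (E n)).trans ?_)
    gcongr
    exact subset_union_right
  · intro n
    refine (kernelEnergy_le_add hk (E n) F).trans ?_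
    beta_reduce
    gcongr
    exact subset_union_left

/-- The positive part of the logarithmic kernel. -/
noncomputable def posKernel (z : Plane) : ℝ≥0∞ := ENNReal.ofReal (Real.log (1 / ‖z‖))

/-- The negative part of the logarithmic kernel. -/
noncomputable def negKernel (z : Plane) : ℝ≥0∞ := ENNReal.ofReal (-Real.log (1 / ‖z‖))

lemma logInteraction_eq (E : Set Plane) : logInteraction E =
    (kernelEnergy posKernel E : EReal) - (kernelEnergy negKernel E : EReal) := rfl

lemma measurable_posKernel : Measurable posKernel :=
  (Real.measurable_log.comp (measurable_norm.const_div 1)).ennreal_ofReal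

lemma measurable_negKernel : Measurable negKernel :=
  (Real.measurable_log.comp (measurable_norm.const_div 1)).neg.ennreal_ofReal

/-- In polar coordinates the integrand is `r log (1 / r)`, which is at most `1` on `(0, 1]` because
`log t ≤ t - 1`; beyond `1` the positive part vanishes. -/
lemma lintegral_posKernel_ne_top : ∫⁻ z, posKernel z ≠ ⊤ := by
  have hint : Integrable (fun z : Plane => (fun r : ℝ => max (Real.log (1 / r)) 0) ‖z‖) := by
    refine (integrable_fun_norm_addHaar volume (f := fun r : ℝ => max (Real.log (1 / r)) 0)).2 ?_
    have hm : Measurable (fun y : ℝ => y ^ (Module.finrank ℝ Plane - 1) •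
        max (Real.log (1 / y)) 0) :=
      (measurable_id.pow_const _).smul
        ((Real.measurable_log.comp (measurable_id.const_div 1)).max measurable_const)
    have hb : IntegrableOn (fun y : ℝ => (Ioc (0 : ℝ) 1).indicator (fun _ => (1 : ℝ)) y)
        (Ioi 0) :=
      ((integrable_indicator_iff measurableSet_Ioc).2
        (integrableOn_const (by simp))).integrableOn
    refine hb.mono' hm.aestronglyMeasurable ?_
    filter_upwards [ae_restrict_mem measurableSet_Ioi] with y hy
    have hy0 : 0 < y := hy
    simp only [finrank_euclideanSpace, Fintype.card_fin, Nat.add_one_sub_one, pow_one,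
      smul_eq_mul]
    rw [Real.norm_of_nonneg (by positivity)]
    by_cases h1 : y ≤ 1
    · rw [indicator_of_mem (show y ∈ Ioc (0 : ℝ) 1 from ⟨hy0, h1⟩)]
      have : Real.log (1 / y) ≤ 1 / y := by
        linarith [Real.log_le_sub_one_of_pos (show 0 < 1 / y by positivity)]
      calc y * max (Real.log (1 / y)) 0 ≤ y * (1 / y) := by
            gcongr; exact max_le this (by positivity)
        _ = 1 := by field_simp
    · have h2 : Real.log (1 / y) ≤ 0 := by
        rw [one_div, Real.log_inv]
        linarith [Real.log_nonneg (not_le.1 h1).le]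
      rw [max_eq_right h2, mul_zero]
      exact indicator_nonneg (fun _ _ => zero_le_one) y
  refine ne_top_of_le_ne_top hint.lintegral_lt_top.ne (lintegral_mono fun z => ?_)
  exact ENNReal.ofReal_le_ofReal (le_max_left _ _)

/-- The negative part of the logarithmic kernel, cut off at distance `R`. -/
noncomputable def cutNegKernel (R : ℝ) : Plane → ℝ≥0∞ :=
  (Metric.closedBall 0 R).indicator negKernel

lemma measurable_cutNegKernel (R : ℝ) : Measurable (cutNegKernel R) :=
  measurable_negKernel.indicator Metric.isClosed_closedBall.measurableSet

lemma negKernel_le {R : ℝ} (hR : 1 ≤ R) {z : Plane} (hz : ‖z‖ ≤ R) :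
    negKernel z ≤ ENNReal.ofReal (Real.log R) := by
  refine ENNReal.ofReal_le_ofReal ?_
  rw [one_div, Real.log_inv, neg_neg]
  -- At the origin the convention `Real.log 0 = 0` makes the kernel vanish; this is where `1 ≤ R`
  -- enters.
  rcases eq_or_lt_of_le (norm_nonneg z) with h | h
  · rw [← h, Real.log_zero]; exact Real.log_nonneg hR
  · exact Real.log_le_log h hz

lemma lintegral_cutNegKernel_ne_top {R : ℝ} (hR : 1 ≤ R) : ∫⁻ z, cutNegKernel R z ≠ ⊤ := by
  rw [cutNegKernel, lintegral_indicator Metric.isClosed_closedBall.measurableSet]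
  refine ne_top_of_le_ne_top ?_ (setLIntegral_mono (g := fun _ => ENNReal.ofReal (Real.log R))
    measurable_const fun z hz => negKernel_le hR (by simpa using hz))
  rw [setLIntegral_const]
  exact ENNReal.mul_ne_top ENNReal.ofReal_ne_top (isCompact_closedBall _ _).measure_ne_top

lemma ae_mem_essSupport (E : Set Plane) :
    ∀ᵐ x ∂(volume.restrict E),
      x ∈ {x : Plane | ∀ r : ℝ, 0 < r → 0 < volume (E ∩ Metric.ball x r)} := by
  refine measure_null_of_locally_null _ fun x hx => ?_
  have hx' : ¬ ∀ r : ℝ, 0 < r → 0 < volume (E ∩ Metric.ball x r) := hx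
  push Not at hx'
  obtain ⟨r, hr, h0⟩ := hx'
  refine ⟨Metric.ball x r, mem_nhdsWithin_of_mem_nhds (Metric.ball_mem_nhds x hr), ?_⟩
  rw [Measure.restrict_apply Metric.isOpen_ball.measurableSet, inter_comm]
  exact le_antisymm h0 zero_le

lemma ae_ae_norm_sub_le {E : Set Plane} {R : ℝ} (h : essDiam E ≤ ENNReal.ofReal R) (hR : 0 ≤ R) :
    ∀ᵐ x ∂(volume.restrict E), ∀ᵐ y ∂(volume.restrict E), ‖x - y‖ ≤ R := by
  filter_upwards [ae_mem_essSupport E] with x hx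
  filter_upwards [ae_mem_essSupport E] with y hy
  have hxy : edist x y ≤ essDiam E := by
    unfold essDiam
    apply Metric.edist_le_ediam_of_mem
    · exact hx
    · exact hy
  have := hxy.trans h
  rw [edist_dist, dist_eq_norm] at this
  exact (ENNReal.ofReal_le_ofReal_iff hR).1 this

/-- Almost all pairs of points are within `R` of each other, so the cut-off is invisible. This gives
access to `L¹` continuity, which requires an integrable kernel. -/
lemma kernelEnergy_negKernel_eq {E : Set Plane} {R : ℝ} (hR : 0 ≤ R)
    (h : essDiam E ≤ ENNReal.ofReal R) :
    kernelEnergy negKernel E = kernelEnergy (cutNegKernel R) E := by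
  refine lintegral_congr_ae ?_
  filter_upwards [ae_ae_norm_sub_le h hR] with x hx
  refine lintegral_congr_ae ?_
  filter_upwards [hx] with y hy
  rw [cutNegKernel, indicator_of_mem (by simpa using hy)]

lemma kernelEnergy_negKernel_le {E : Set Plane} {R : ℝ} (hR : 1 ≤ R)
    (h : essDiam E ≤ ENNReal.ofReal R) :
    kernelEnergy negKernel E ≤ ENNReal.ofReal (Real.log R) * volume E * volume E := by
  unfold kernelEnergy
  rw [← setLIntegral_const E]
  refine lintegral_mono_ae ?_
  filter_upwards [ae_ae_norm_sub_le h (zero_le_one.trans hR)] with x hx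
  rw [← setLIntegral_const]
  refine lintegral_mono_ae ?_
  filter_upwards [hx] with y hy using negKernel_le hR hy

/-! ### Balls have finite perimeter; the two approximation classes -/

lemma abs_setIntegral_translate_sub_le {E : Set Plane} (hE : MeasurableSet E)
    (hfin : volume E ≠ ⊤) {g : Plane → ℝ} (hg : Continuous g) (hgc : HasCompactSupport g)
    (hg1 : ∀ x, |g x| ≤ 1) (v : Plane) :
    |(∫ x in E, g (x + v)) - ∫ x in E, g x| ≤
      volume.real (symmDiff ((fun x => x - v) ⁻¹' E) E) := by
  have hmp : MeasurePreserving (fun x : Plane => x - v) := measurePreserving_sub_right volume v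
  set G : Set Plane := (fun x => x - v) ⁻¹' E with hG
  have hGm : MeasurableSet G := hmp.measurable hE
  have hGfin : volume G ≠ ⊤ := by rwa [hG, hmp.measure_preimage hE.nullMeasurableSet]
  have hint : Integrable g := hg.integrable_of_hasCompactSupport hgc
  have e1 : ∫ x in E, g (x + v) = ∫ x in G, g x := by
    have := hmp.setIntegral_preimage_emb (measurableEmbedding_subRight v)
      (fun x => g (x + v)) E
    simpa using this.symm
  have hDm : MeasurableSet (symmDiff G E) := hGm.symmDiff hE
  have hDfin : volume (symmDiff G E) ≠ ⊤ :=
    ne_top_of_le_ne_top (ENNReal.add_ne_top.2 ⟨hGfin, hfin⟩)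
      ((measure_mono symmDiff_subset_union).trans (measure_union_le _ _))
  rw [e1, ← integral_indicator hGm, ← integral_indicator hE,
    ← integral_sub (hint.indicator hGm) (hint.indicator hE), ← Real.norm_eq_abs]
  have i2 : Integrable ((symmDiff G E).indicator (fun _ => (1 : ℝ))) :=
    (integrable_indicator_iff hDm).2 (integrableOn_const hDfin)
  refine (norm_integral_le_of_norm_le i2 (ae_of_all _ fun x => ?_)).trans_eq ?_
  · have := hg1 x
    by_cases h1 : x ∈ G <;> by_cases h2 : x ∈ E <;> simp [h1, h2, mem_symmDiff, this]
  · rw [integral_indicator hDm]; simp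

lemma volume_real_symmDiff_ball_le {R : ℝ} (v : Plane) (hv : ‖v‖ ≤ R) :
    volume.real (symmDiff ((fun x => x - v) ⁻¹' Metric.ball (0 : Plane) R) (Metric.ball 0 R)) ≤
      4 * R * volume.real (Metric.ball (0 : Plane) 1) * ‖v‖ := by
  have hR : 0 ≤ R := (norm_nonneg v).trans hv
  have hvol : ∀ r : ℝ, 0 ≤ r → volume.real (Metric.ball (0 : Plane) r) =
      r ^ 2 * volume.real (Metric.ball (0 : Plane) 1) := by
    intro r hr
    rw [measureReal_def, measureReal_def, Measure.addHaar_ball _ _ hr, ENNReal.toReal_mul,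
      ENNReal.toReal_ofReal (by positivity)]
    simp
  -- The ball and its translate differ only inside an annulus of width `2 * ‖v‖`, whose area is
  -- linear in `‖v‖`.
  have hsub : symmDiff ((fun x => x - v) ⁻¹' Metric.ball (0 : Plane) R) (Metric.ball 0 R) ⊆
      Metric.ball 0 (R + ‖v‖) \ Metric.ball 0 (R - ‖v‖) := by
    intro x hx
    have h1 : ‖x‖ ≤ ‖x - v‖ + ‖v‖ := by simpa using norm_add_le (x - v) v
    have h2 : ‖x - v‖ ≤ ‖x‖ + ‖v‖ := norm_sub_le x v
    have h3 := norm_nonneg v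
    simp only [mem_symmDiff, mem_preimage, Metric.mem_ball, dist_zero_right, not_lt,
      Set.mem_sdiff] at hx ⊢
    obtain ⟨ha, hb⟩ | ⟨ha, hb⟩ := hx <;> constructor <;> linarith
  refine (measureReal_mono hsub (measure_ne_top_of_subset sdiff_subset
    measure_ball_lt_top.ne)).trans ?_
  rw [measureReal_sdiff (Metric.ball_subset_ball (by linarith [norm_nonneg v]))
    Metric.isOpen_ball.measurableSet measure_ball_lt_top.ne,
    hvol (R + ‖v‖) (by positivity), hvol (R - ‖v‖) (by linarith)]
  apply le_of_eq; ring

lemma hasDerivAt_setIntegral_translate {E : Set Plane} (hfin : volume E ≠ ⊤) {g : Plane → ℝ}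
    (hg : ContDiff ℝ 1 g) (hgc : HasCompactSupport g) (v : Plane) :
    HasDerivAt (fun s : ℝ => ∫ x in E, g (x + s • v)) (∫ x in E, fderiv ℝ g x v) 0 := by
  have hcont := hg.continuous_fderiv one_ne_zero
  obtain ⟨C, hC⟩ := (hgc.fderiv (𝕜 := ℝ)).exists_bound_of_continuous hcont
  have hfm : IsFiniteMeasure (volume.restrict E) := ⟨by simpa using hfin.lt_top⟩
  have hint : Integrable g := hg.continuous.integrable_of_hasCompactSupport hgc
  have := (hasDerivAt_integral_of_dominated_loc_of_deriv_le (μ := volume.restrict E)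
    (F := fun (s : ℝ) x => g (x + s • v)) (F' := fun (s : ℝ) x => fderiv ℝ g (x + s • v) v)
    (x₀ := 0) (s := univ) (bound := fun _ => C * ‖v‖) Filter.univ_mem ?_ ?_ ?_ ?_ ?_ ?_).2
  · simpa using this
  · exact Eventually.of_forall fun s => by
      have := hg.continuous
      exact Continuous.aestronglyMeasurable (by fun_prop)
  · simpa using hint.integrableOn.integrable
  · exact Continuous.aestronglyMeasurable (by fun_prop)
  · exact ae_of_all _ fun x s _ => ((fderiv ℝ g _).le_opNorm v).trans (by gcongr; exact hC _)
  · exact integrable_const _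
  · refine ae_of_all _ fun x s _ => ?_
    have h1 : HasDerivAt (fun s : ℝ => x + s • v) v s := by
      simpa using ((hasDerivAt_id s).smul_const v).const_add x
    exact ((hg.differentiable one_ne_zero) _).hasFDerivAt.comp_hasDerivAt s h1

/-- The integral is the derivative at `0` of the integral of a translated `g`, and the increments of
the latter are bounded by the area swept by the moving ball. This avoids the divergence theorem;
only finiteness is needed, so the constant is crude. -/
lemma setIntegral_ball_fderiv_le {R : ℝ} (hR : 0 < R) {g : Plane → ℝ}
    (hg : ContDiff ℝ 1 g) (hgc : HasCompactSupport g) (hg1 : ∀ x, |g x| ≤ 1) {v : Plane}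
    (hv : ‖v‖ = 1) :
    |∫ x in Metric.ball 0 R, fderiv ℝ g x v| ≤
      4 * R * volume.real (Metric.ball (0 : Plane) 1) := by
  have hd := hasDerivAt_setIntegral_translate (E := Metric.ball (0 : Plane) R)
    measure_ball_lt_top.ne hg hgc v
  rw [← Real.norm_eq_abs]
  refine hd.le_of_lip' (by positivity) ?_
  filter_upwards [Metric.ball_mem_nhds (0 : ℝ) hR] with s hs
  have hs' : ‖s • v‖ ≤ R := by
    rw [norm_smul, hv, mul_one]; simpa using (Metric.mem_ball.1 hs).le
  have h1 := abs_setIntegral_translate_sub_le (E := Metric.ball (0 : Plane) R)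
    Metric.isOpen_ball.measurableSet measure_ball_lt_top.ne hg.continuous hgc hg1 (s • v)
  have h2 := volume_real_symmDiff_ball_le (R := R) (s • v) hs'
  rw [norm_smul, hv, mul_one] at h2
  simpa using h1.trans h2

lemma perimeter_ball_lt_top {R : ℝ} (hR : 0 < R) :
    perimeter (Metric.ball (0 : Plane) R) < ⊤ := by
  refine lt_of_le_of_lt (b := ENNReal.ofReal
    (2 * (4 * R * volume.real (Metric.ball (0 : Plane) 1)))) ?_ ENNReal.ofReal_lt_top
  refine iSup₂_le fun φ ⟨h1, h2, h3⟩ => ENNReal.ofReal_le_ofReal ?_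
  have hproj : ∀ i : Fin 2, ContDiff ℝ 1 (fun x => φ x i) := fun i => by fun_prop
  have hcs : ∀ i : Fin 2, HasCompactSupport (fun x => φ x i) := fun i =>
    h2.comp_left (g := fun y : Plane => y i) (by simp)
  have hle : ∀ i : Fin 2, ∀ x, |φ x i| ≤ 1 := fun i x =>
    (PiLp.norm_apply_le (φ x) i).trans (h3 x)
  have hfd : ∀ i : Fin 2, ∀ x v, fderiv ℝ φ x v i = fderiv ℝ (fun x => φ x i) x v := by
    intro i x v
    have hd : HasFDerivAt φ (fderiv ℝ φ x) x :=
      ((h1.differentiable one_ne_zero) x).hasFDerivAt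
    have := ((EuclideanSpace.proj (𝕜 := ℝ) i).hasFDerivAt (x := φ x)).comp x hd
    have h4 : fderiv ℝ (fun x => φ x i) x =
      (EuclideanSpace.proj (𝕜 := ℝ) i).comp (fderiv ℝ φ x) := this.fderiv
    rw [h4]; rfl
  have hint : ∀ i : Fin 2, IntegrableOn
      (fun x => fderiv ℝ (fun x => φ x i) x (EuclideanSpace.single i 1)) (Metric.ball 0 R) := by
    intro i
    have hc := (hproj i).continuous_fderiv one_ne_zero
    refine (Continuous.integrable_of_hasCompactSupport (by fun_prop) ?_).integrableOn
    exact (hcs i).fderiv_apply ℝ _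
  simp only [divergence, hfd]
  rw [integral_finsetSum _ fun i _ => hint i, Fin.sum_univ_two, two_mul]
  exact add_le_add
    ((le_abs_self _).trans (setIntegral_ball_fderiv_le hR (hproj 0) (hcs 0) (hle 0) (by simp)))
    ((le_abs_self _).trans (setIntegral_ball_fderiv_le hR (hproj 1) (hcs 1) (hle 1) (by simp)))

lemma isSmoothSet_ball {R : ℝ} (hR : 0 < R) : IsSmoothSet (Metric.ball (0 : Plane) R) := by
  refine ⟨Metric.isOpen_ball, fun x hx => ?_⟩
  rw [frontier_ball _ hR.ne', mem_sphere_zero_iff_norm] at hx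
  refine ⟨fun y => ‖y‖ ^ 2 - R ^ 2, (contDiff_norm_sq ℝ).sub contDiff_const, ?_,
    Eventually.of_forall fun y => ?_⟩
  · intro h
    have h1 : fderiv ℝ (fun y : Plane => ‖y‖ ^ 2 - R ^ 2) x = 2 • innerSL ℝ x := by
      rw [fderiv_sub_const]
      exact (hasStrictFDerivAt_norm_sq x).hasFDerivAt.fderiv
    rw [h1] at h
    have h2 := congrArg (fun L : Plane →L[ℝ] ℝ => L x) h
    simp only [smul_apply, innerSL_apply_apply, real_inner_self_eq_norm_sq,
      hx, zero_apply] at h2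
    have : 0 < R ^ 2 := by positivity
    simp at h2
    linarith
  · rw [mem_ball_zero_iff, sub_neg, sq_lt_sq₀ (norm_nonneg y) hR.le]

lemma IsSmoothSet.translate {F : Set Plane} (hF : IsSmoothSet F) (a : Plane) :
    IsSmoothSet ((fun x => x + a) ⁻¹' F) := by
  have hc : Continuous (fun x : Plane => x + a) := by fun_prop
  refine ⟨hF.1.preimage hc, fun x hx => ?_⟩
  have hx' : x + a ∈ frontier F := by
    have := (Homeomorph.addRight a).preimage_frontier F
    change (fun x => x + a) ⁻¹' frontier F = frontier ((fun x => x + a) ⁻¹' F) at this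
    rw [← this] at hx
    exact hx
  obtain ⟨ψ, h1, h2, h3⟩ := hF.2 _ hx'
  refine ⟨fun y => ψ (y + a), by fun_prop, by rwa [fderiv_comp_add_right], ?_⟩
  exact (hc.tendsto x).eventually h3

lemma isApproxClass_connected : IsApproxClass fun F => IsConnected F ∧ IsSmoothSet F where
  isOpen h := h.2.1
  isConnected h := h.1
  translate h a := ⟨(Homeomorph.addRight a).isConnected_preimage.2 h.1, h.2.translate a⟩
  ball r hr := ⟨(convex_ball 0 r).isConnected (Metric.nonempty_ball.2 hr), isSmoothSet_ball hr⟩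

lemma isApproxClass_simplyConnected :
    IsApproxClass fun F => IsSimplyConnected F ∧ IsSmoothSet F where
  isOpen h := h.2.1
  isConnected h := h.1.isPathConnected.isConnected
  translate h a := ⟨(Homeomorph.addRight a).isSimplyConnected_preimage.2 h.1, h.2.translate a⟩
  ball r hr := by
    refine ⟨?_, isSmoothSet_ball hr⟩
    have := (convex_ball (0 : Plane) r).contractibleSpace (Metric.nonempty_ball.2 hr)
    exact (inferInstance : SimplyConnectedSpace (Metric.ball (0 : Plane) r))

/-! ### Coercivity and the direct method -/

/-- The energy as a real number, where it is finite. -/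
noncomputable def realEnergy (P : Set Plane → ℝ≥0∞) (lam : ℝ) (E : Set Plane) : ℝ :=
  (P E).toReal +
    lam * ((kernelEnergy posKernel E).toReal - (kernelEnergy negKernel E).toReal)

lemma kernelEnergy_posKernel_ne_top {E : Set Plane} (hE : volume E ≠ ⊤) :
    kernelEnergy posKernel E ≠ ⊤ :=
  ne_top_of_le_ne_top (ENNReal.mul_ne_top lintegral_posKernel_ne_top hE)
    (kernelEnergy_le_lintegral_mul _ _)

variable {A : Set Plane → Prop} {m lam : ℝ} {E : Set Plane}

lemma IsAdmissible.volume_ne_top (hE : IsAdmissible m E) : volume E ≠ ⊤ := by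
  rw [hE.2]; exact ENNReal.ofReal_ne_top

lemma essDiam_le_ofReal (hA : IsApproxClass A) (hE : volume E ≠ ⊤)
    (hP : relaxedPerimeter A E ≠ ⊤) :
    essDiam E ≤ ENNReal.ofReal (2 * (relaxedPerimeter A E).toReal) := by
  rw [ENNReal.ofReal_mul zero_le_two, ENNReal.ofReal_toReal hP, ENNReal.ofReal_ofNat]
  exact essDiam_le hA hE

/-- The diameter is at most `2 * P`, so the kernel is at most the logarithm of that; the extra `1`
keeps the radius at least `1`. -/
lemma toReal_kernelEnergy_negKernel_le (hA : IsApproxClass A) (hm : 0 < m)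
    (hE : IsAdmissible m E) (hP : relaxedPerimeter A E ≠ ⊤) :
    kernelEnergy negKernel E ≠ ⊤ ∧ (kernelEnergy negKernel E).toReal ≤
      Real.log (2 * (relaxedPerimeter A E).toReal + 1) * m * m := by
  set p := (relaxedPerimeter A E).toReal with hp
  have hp0 : 0 ≤ p := ENNReal.toReal_nonneg
  have h := kernelEnergy_negKernel_le (E := E) (R := 2 * p + 1) (by linarith)
    ((essDiam_le_ofReal hA hE.volume_ne_top hP).trans
      (ENNReal.ofReal_le_ofReal (by linarith)))
  have hlog : 0 ≤ Real.log (2 * p + 1) := Real.log_nonneg (by linarith)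
  rw [hE.2, ← ENNReal.ofReal_mul hlog, ← ENNReal.ofReal_mul (by positivity)] at h
  exact ⟨ne_top_of_le_ne_top ENNReal.ofReal_ne_top h,
    ENNReal.toReal_le_of_le_ofReal (by positivity) h⟩

lemma energy_eq_realEnergy (hA : IsApproxClass A) (hm : 0 < m) (hE : IsAdmissible m E)
    (hP : relaxedPerimeter A E ≠ ⊤) :
    energy (relaxedPerimeter A) lam E = (realEnergy (relaxedPerimeter A) lam E : EReal) := by
  have h1 := kernelEnergy_posKernel_ne_top hE.volume_ne_top
  have h2 := (toReal_kernelEnergy_negKernel_le hA hm hE hP).1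
  rw [energy, if_neg hP, logInteraction_eq, realEnergy, ← EReal.coe_ennreal_toReal hP,
    ← EReal.coe_ennreal_toReal h1, ← EReal.coe_ennreal_toReal h2]
  norm_cast

/-- The perimeter is controlled by the energy, since the interaction only diverges
logarithmically in the diameter. -/
lemma exists_perimeter_le_two_mul_energy_add (hA : IsApproxClass A) (hm : 0 < m)
    (hlam : 0 < lam) : ∃ K : ℝ, ∀ E, IsAdmissible m E → relaxedPerimeter A E ≠ ⊤ →
      (relaxedPerimeter A E).toReal ≤ 2 * (realEnergy (relaxedPerimeter A) lam E + K) := by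
  set a := lam * m * m with ha
  have ha0 : 0 < a := by positivity
  -- The bound `log t ≤ t - 1` at `t = (2 * p + 1) / (4 * a)` gives `a log (2p + 1) ≤ p / 2 + K`
  -- with exactly this `K`, so half of the perimeter survives.
  refine ⟨1 / 4 - a + a * Real.log (4 * a), fun E hE hP => ?_⟩
  have h := (toReal_kernelEnergy_negKernel_le hA hm hE hP).2
  rw [realEnergy]
  set p := (relaxedPerimeter A E).toReal with hp
  have hp0 : 0 ≤ p := ENNReal.toReal_nonneg
  have h1 : Real.log (2 * p + 1) ≤ (2 * p + 1) / (4 * a) - 1 + Real.log (4 * a) := by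
    have := Real.log_le_sub_one_of_pos (show 0 < (2 * p + 1) / (4 * a) by positivity)
    rw [Real.log_div (by positivity) (by positivity)] at this
    linarith
  have h2 : a * Real.log (2 * p + 1) ≤ (2 * p + 1) / 4 - a + a * Real.log (4 * a) := by
    calc _ ≤ a * ((2 * p + 1) / (4 * a) - 1 + Real.log (4 * a)) := by gcongr
      _ = _ := by field_simp
  have h3 : lam * (kernelEnergy negKernel E).toReal ≤ a * Real.log (2 * p + 1) := by
    calc _ ≤ lam * (Real.log (2 * p + 1) * m * m) := by gcongr
      _ = _ := by rw [ha]; ring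
  have h4 : 0 ≤ lam * (kernelEnergy posKernel E).toReal := by positivity
  linarith

lemma exists_isAdmissible_relaxedPerimeter_ne_top (hA : IsApproxClass A) (hm : 0 < m) :
    ∃ E, IsAdmissible m E ∧ relaxedPerimeter A E ≠ ⊤ := by
  set c := volume.real (Metric.ball (0 : Plane) 1) with hc
  have hc0 : 0 < c := ENNReal.toReal_pos (Metric.measure_ball_pos _ _ one_pos).ne'
    measure_ball_lt_top.ne
  have hr : 0 < √(m / c) := Real.sqrt_pos.2 (by positivity)
  refine ⟨Metric.ball 0 √(m / c), ⟨Metric.isOpen_ball.measurableSet, ?_⟩, ?_⟩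
  · rw [Measure.addHaar_ball _ _ hr.le, ← ENNReal.ofReal_toReal
      (measure_ball_lt_top (μ := volume) (x := (0 : Plane)) (r := 1)).ne,
      ← ENNReal.ofReal_mul (by positivity)]
    congr 1
    rw [finrank_euclideanSpace, Fintype.card_fin, Real.sq_sqrt (by positivity)]
    exact div_mul_cancel₀ m hc0.ne'
  · refine ((iInf₂_le (fun _ => Metric.ball 0 √(m / c)) ⟨fun _ => hA.ball _ hr, ?_⟩).trans_lt
      ?_).ne
    · simpa using perimeter_ball_lt_top hr
    · simp

lemma exists_approx (hP : relaxedPerimeter A E ≠ ⊤) {ε : ℝ≥0∞} (hε : 0 < ε) :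
    ∃ F, A F ∧ volume (symmDiff F E) < ε ∧ perimeter F < relaxedPerimeter A E + ε := by
  have h := ENNReal.lt_add_right hP hε.ne'
  set c := relaxedPerimeter A E + ε
  unfold relaxedPerimeter at h
  simp only [iInf_lt_iff] at h
  obtain ⟨F, ⟨hF, hFE⟩, hlim⟩ := h
  obtain ⟨n, h1, h2⟩ := ((frequently_lt_of_liminf_lt (by isBoundedDefault) hlim).and_eventually
    (hFE.eventually (gt_mem_nhds hε))).exists
  exact ⟨F n, hF n, h2, h1⟩

/-- Moving a point of the approximant to the origin turns the diameter bound into containment in a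
centred ball, which removes the translation invariance of the problem. -/
lemma exists_translated_approx (hA : IsApproxClass A) (hE : volume E ≠ ⊤)
    (hP : relaxedPerimeter A E ≠ ⊤) {ε : ℝ≥0∞} (hε : 0 < ε) (hε' : ε ≠ ⊤) :
    ∃ (a : Plane) (F : Set Plane), A F ∧
      volume (symmDiff F ((fun x => x + a) ⁻¹' E)) < ε ∧
      perimeter F < relaxedPerimeter A E + ε ∧
      F ⊆ Metric.closedBall 0 (2 * (relaxedPerimeter A E + ε).toReal) := by
  obtain ⟨G, hG, hGE, hGP⟩ := exists_approx hP hε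
  obtain ⟨a, ha⟩ := (hA.isConnected hG).nonempty
  have hGfin : volume G ≠ ⊤ := volume_ne_top_of_symmDiff hE hGE.ne_top
  have hpre : volume ((fun x => x + a) ⁻¹' symmDiff G E) = volume (symmDiff G E) := by
    rw [measure_preimage_add_right]
  refine ⟨a, (fun x => x + a) ⁻¹' G, hA.translate hG a, ?_, ?_, fun x hx => ?_⟩
  · rw [← preimage_symmDiff, hpre]; exact hGE
  · rw [perimeter_translate]; exact hGP
  · have h1 := edist_le_two_mul_perimeter (hA.isOpen hG) (hA.isConnected hG) hGfin hx ha
    have h2 : edist (x + a) a ≤ 2 * (relaxedPerimeter A E + ε) :=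
      h1.trans (by gcongr)
    rw [edist_dist, dist_eq_norm, add_sub_cancel_right] at h2
    have h3 := (ENNReal.ofReal_le_iff_le_toReal (by finiteness)).1 h2
    simpa using h3

lemma volume_eq_of_tendsto_symmDiff {F : ℕ → Set Plane} (hF : ∀ n, IsAdmissible m (F n))
    (hE : MeasurableSet E) (h : Tendsto (fun n => volume (symmDiff (F n) E)) atTop (𝓝 0)) :
    volume E = ENNReal.ofReal m := by
  let u : ℕ → MeasuredSets (volume : Measure Plane) := fun n => ⟨F n, (hF n).1⟩
  let L : MeasuredSets (volume : Measure Plane) := ⟨E, hE⟩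
  have hu : Tendsto u atTop (𝓝 L) := tendsto_iff_edist_tendsto_0.2 h
  have h1 := (MeasuredSets.continuous_measure.tendsto L).comp hu
  refine tendsto_nhds_unique h1 (tendsto_const_nhds.congr fun n => ?_)
  exact (hF n).2.symm

lemma IsAdmissible.translate (hE : IsAdmissible m E) (a : Plane) :
    IsAdmissible m ((fun x => x + a) ⁻¹' E) :=
  ⟨(measurable_add_const a) hE.1, by rw [measure_preimage_add_right, hE.2]⟩

/-- The direct method: a sequence of competitors of bounded perimeter whose energies converge
has, up to translations, a limit competitor with no larger energy. -/
lemma exists_realEnergy_le_of_tendsto (hA : IsApproxClass A) (hm : 0 < m)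
    {E : ℕ → Set Plane} (hE : ∀ n, IsAdmissible m (E n))
    (hP : ∀ n, relaxedPerimeter A (E n) ≠ ⊤) {M J : ℝ}
    (hM : ∀ n, (relaxedPerimeter A (E n)).toReal ≤ M)
    (hJ : Tendsto (fun n => realEnergy (relaxedPerimeter A) lam (E n)) atTop (𝓝 J)) :
    ∃ L, IsAdmissible m L ∧ relaxedPerimeter A L ≠ ⊤ ∧
      realEnergy (relaxedPerimeter A) lam L ≤ J := by
  have hM0 : 0 ≤ M := ENNReal.toReal_nonneg.trans (hM 0)
  let ε : ℕ → ℝ := fun n => 1 / ((n : ℝ) + 1)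
  have hε : ∀ n, 0 < ε n := fun n => Nat.one_div_pos_of_nat
  have hε1 : ∀ n, ε n ≤ 1 := fun n => by
    rw [div_le_one (by positivity)]; linarith [n.cast_nonneg (α := ℝ)]
  have hεlim : Tendsto ε atTop (𝓝 0) := tendsto_one_div_add_atTop_nhds_zero_nat
  have hPr : ∀ n, relaxedPerimeter A (E n) + ENNReal.ofReal (ε n) =
      ENNReal.ofReal ((relaxedPerimeter A (E n)).toReal + ε n) := fun n => by
    rw [ENNReal.ofReal_add ENNReal.toReal_nonneg (hε n).le, ENNReal.ofReal_toReal (hP n)]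
  choose a F hFA hFE hFP hFR using fun n => exists_translated_approx hA (hE n).volume_ne_top
    (hP n) (ENNReal.ofReal_pos.2 (hε n)) ENNReal.ofReal_ne_top
  simp only [hPr] at hFP hFR
  have hFR' : ∀ n, F n ⊆ Metric.closedBall 0 (2 * (M + 1)) := fun n => by
    refine (hFR n).trans (Metric.closedBall_subset_closedBall ?_)
    rw [ENNReal.toReal_ofReal (add_nonneg ENNReal.toReal_nonneg (hε n).le)]
    linarith [hM n, hε1 n]
  have hFP' : ∀ n, perimeter (F n) ≤ ENNReal.ofReal (M + 1) := fun n =>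
    (hFP n).le.trans (ENNReal.ofReal_le_ofReal (by linarith [hM n, hε1 n]))
  obtain ⟨L, hL, φ, hφ, hlim⟩ := exists_subseq_tendsto_volume_symmDiff
    (fun n => (hA.isOpen (hFA n)).measurableSet) hFR' ENNReal.ofReal_ne_top hFP'
  let E' : ℕ → Set Plane := fun n => (fun x => x + a (φ n)) ⁻¹' E (φ n)
  have hE' : ∀ n, IsAdmissible m (E' n) := fun n => (hE _).translate _
  have hεφ : Tendsto (fun n => ε (φ n)) atTop (𝓝 0) := hεlim.comp hφ.tendsto_atTop
  have hlim' : Tendsto (fun n => volume (symmDiff (E' n) L)) atTop (𝓝 0) := by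
    have h0 : Tendsto (fun n => ENNReal.ofReal (ε (φ n)) + volume (symmDiff (F (φ n)) L)) atTop
        (𝓝 0) := by
      simpa using ((ENNReal.continuous_ofReal.tendsto 0).comp hεφ).add hlim
    refine tendsto_of_tendsto_of_tendsto_of_le_of_le tendsto_const_nhds h0
      (fun _ => zero_le) fun n => ?_
    refine (measure_symmDiff_le _ (F (φ n)) _).trans (add_le_add ?_ le_rfl)
    rw [symmDiff_comm]
    exact (hFE (φ n)).le
  have hLadm : IsAdmissible m L := ⟨hL, volume_eq_of_tendsto_symmDiff hE' hL hlim'⟩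
  -- The approximants themselves are admissible in the relaxation at `L`, so no separate lower
  -- semicontinuity result is needed.
  have hLP : relaxedPerimeter A L ≤ liminf (fun n => perimeter (F (φ n))) atTop :=
    iInf₂_le (fun n => F (φ n)) ⟨fun n => hFA _, hlim⟩
  have hLM : relaxedPerimeter A L ≤ ENNReal.ofReal (M + 1) :=
    hLP.trans (liminf_le_of_le (by isBoundedDefault) fun b hb => by
      obtain ⟨n, hn⟩ := hb.exists
      exact hn.trans (hFP' _))
  have hLtop : relaxedPerimeter A L ≠ ⊤ := ne_top_of_le_ne_top ENNReal.ofReal_ne_top hLM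
  refine ⟨L, hLadm, hLtop, ?_⟩
  have hpos : Tendsto (fun n => (kernelEnergy posKernel (E (φ n))).toReal) atTop
      (𝓝 (kernelEnergy posKernel L).toReal) := by
    refine (ENNReal.tendsto_toReal (kernelEnergy_posKernel_ne_top hLadm.volume_ne_top)).comp ?_
    have := tendsto_kernelEnergy measurable_posKernel lintegral_posKernel_ne_top
      hLadm.volume_ne_top hlim'
    simpa only [E', kernelEnergy_translate] using this
  have hneg : Tendsto (fun n => (kernelEnergy negKernel (E (φ n))).toReal) atTop
      (𝓝 (kernelEnergy negKernel L).toReal) := by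
    refine (ENNReal.tendsto_toReal
      (toReal_kernelEnergy_negKernel_le hA hm hLadm hLtop).1).comp ?_
    -- One cut-off radius serves the whole sequence and its limit, whose relaxed perimeter is only
    -- known to be at most `M + 1`.
    set R := 2 * (M + 1) with hR
    have hR1 : 1 ≤ R := by rw [hR]; linarith
    have hcut : ∀ {B : Set Plane}, IsAdmissible m B → relaxedPerimeter A B ≠ ⊤ →
        (relaxedPerimeter A B).toReal ≤ M + 1 →
        kernelEnergy negKernel B = kernelEnergy (cutNegKernel R) B := fun hB hBP hBM =>
      kernelEnergy_negKernel_eq (by linarith)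
        ((essDiam_le_ofReal hA hB.volume_ne_top hBP).trans
          (ENNReal.ofReal_le_ofReal (by linarith)))
    have := tendsto_kernelEnergy (measurable_cutNegKernel R) (lintegral_cutNegKernel_ne_top hR1)
      hLadm.volume_ne_top hlim'
    simp only [E', kernelEnergy_translate] at this
    rw [hcut hLadm hLtop (ENNReal.toReal_le_of_le_ofReal (by linarith) hLM)]
    refine this.congr fun n => (hcut (hE _) (hP _) ?_).symm
    linarith [hM (φ n)]
  -- Energies and interactions both converge, hence so do the relaxed perimeters, and `q` is their
  -- limit.
  set q := J - lam * ((kernelEnergy posKernel L).toReal - (kernelEnergy negKernel L).toReal)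
    with hq
  have hp : Tendsto (fun n => (relaxedPerimeter A (E (φ n))).toReal) atTop (𝓝 q) := by
    refine ((hJ.comp hφ.tendsto_atTop).sub ((hpos.sub hneg).const_mul lam)).congr fun n => ?_
    simp [realEnergy]
  have hq0 : 0 ≤ q := ge_of_tendsto' hp fun n => ENNReal.toReal_nonneg
  have hLq : relaxedPerimeter A L ≤ ENNReal.ofReal q := by
    have h1 : Tendsto (fun n => ENNReal.ofReal ((relaxedPerimeter A (E (φ n))).toReal + ε (φ n)))
        atTop (𝓝 (ENNReal.ofReal q)) := by
      refine (ENNReal.continuous_ofReal.tendsto q).comp ?_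
      simpa using hp.add hεφ
    rw [← h1.liminf_eq]
    exact hLP.trans (liminf_le_liminf (Eventually.of_forall fun n => (hFP _).le))
  have := ENNReal.toReal_le_of_le_ofReal hq0 hLq
  rw [realEnergy]
  linarith

lemma exists_isMinimizer (hA : IsApproxClass A) (hm : 0 < m) (hlam : 0 < lam) :
    ∃ E, IsMinimizer (relaxedPerimeter A) m lam E ∧
      energy (relaxedPerimeter A) lam E ≠ ⊤ ∧ energy (relaxedPerimeter A) lam E ≠ ⊥ := by
  obtain ⟨K, hK⟩ := exists_perimeter_le_two_mul_energy_add hA hm hlam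
  let S : Set ℝ := {e | ∃ E, IsAdmissible m E ∧ relaxedPerimeter A E ≠ ⊤ ∧
    realEnergy (relaxedPerimeter A) lam E = e}
  have hne : S.Nonempty := by
    obtain ⟨E, hE, hP⟩ := exists_isAdmissible_relaxedPerimeter_ne_top hA hm
    exact ⟨_, E, hE, hP, rfl⟩
  have hbdd : BddBelow S := by
    refine ⟨-K, ?_⟩
    rintro _ ⟨E, hE, hP, rfl⟩
    have h := hK E hE hP
    have h0 : 0 ≤ (relaxedPerimeter A E).toReal := ENNReal.toReal_nonneg
    linarith
  obtain ⟨u, hu, hlim, huS⟩ := exists_seq_tendsto_sInf hne hbdd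
  choose E hE hP hEu using huS
  -- The minimizing sequence `u` is nonincreasing, so coercivity bounds all perimeters in terms of
  -- `u 0`.
  obtain ⟨L, hL, hLP, hLJ⟩ := exists_realEnergy_le_of_tendsto (lam := lam) hA hm hE hP
    (M := 2 * (u 0 + K)) (J := sInf S)
    (fun n => (hK _ (hE n) (hP n)).trans (by linarith [hEu n, hu (Nat.zero_le n)]))
    (hlim.congr fun n => (hEu n).symm)
  have hLe := energy_eq_realEnergy (lam := lam) hA hm hL hLP
  refine ⟨L, ⟨hL, fun F hF => ?_⟩, ?_, ?_⟩
  · by_cases hFP : relaxedPerimeter A F = ⊤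
    · rw [energy, energy, if_pos hFP]; exact le_top
    · rw [hLe, energy_eq_realEnergy hA hm hF hFP, EReal.coe_le_coe_iff]
      exact hLJ.trans (csInf_le hbdd ⟨F, hF, hFP, rfl⟩)
  · rw [hLe]; exact EReal.coe_ne_top _
  · rw [hLe]; exact EReal.coe_ne_bot _

lemma exists_essDiam_lt (hA : IsApproxClass A) (hm : 0 < m) (hlam : 0 < lam) :
    ∃ C : ℝ, 0 < C ∧ ∀ E, IsMinimizer (relaxedPerimeter A) m lam E →
      essDiam E < ENNReal.ofReal C := by
  obtain ⟨K, hK⟩ := exists_perimeter_le_two_mul_energy_add hA hm hlam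
  obtain ⟨B, hB, hBP⟩ := exists_isAdmissible_relaxedPerimeter_ne_top hA hm
  have hBe := energy_eq_realEnergy (lam := lam) hA hm hB hBP
  have hB0 : 0 ≤ 2 * (realEnergy (relaxedPerimeter A) lam B + K) :=
    ENNReal.toReal_nonneg.trans (hK B hB hBP)
  -- A minimizer has energy at most that of the fixed competitor `B`; coercivity bounds its
  -- perimeter, the factor `2` passes to the diameter, and the added `1` makes the inequality
  -- strict.
  refine ⟨2 * (2 * (realEnergy (relaxedPerimeter A) lam B + K)) + 1, by linarith,
    fun E hE => ?_⟩
  have hle := hE.2 B hB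
  have hP : relaxedPerimeter A E ≠ ⊤ := by
    intro h
    rw [energy, if_pos h, hBe] at hle
    exact EReal.coe_ne_top _ (top_le_iff.1 hle)
  rw [energy_eq_realEnergy hA hm hE.1 hP, hBe, EReal.coe_le_coe_iff] at hle
  refine (essDiam_le_ofReal hA hE.1.volume_ne_top hP).trans_lt
    ((ENNReal.ofReal_lt_ofReal_iff (by linarith)).2 ?_)
  linarith [hK E hE.1 hP]

end ConnPerim

theorem theorem3p3 (m lam : ℝ) (hm : 0 < m) (hlam : 0 < lam) :
    (∃ E : Set ConnPerim.Plane,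
      ConnPerim.IsMinimizer ConnPerim.connectedPerimeter m lam E ∧
        ConnPerim.energy ConnPerim.connectedPerimeter lam E ≠ ⊤ ∧
        ConnPerim.energy ConnPerim.connectedPerimeter lam E ≠ ⊥) ∧
    (∃ E : Set ConnPerim.Plane,
      ConnPerim.IsMinimizer ConnPerim.simplyConnectedPerimeter m lam E ∧
        ConnPerim.energy ConnPerim.simplyConnectedPerimeter lam E ≠ ⊤ ∧
        ConnPerim.energy ConnPerim.simplyConnectedPerimeter lam E ≠ ⊥) ∧
    ∃ C : ℝ, 0 < C ∧ ∀ E : Set ConnPerim.Plane,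
      (ConnPerim.IsMinimizer ConnPerim.connectedPerimeter m lam E ∨
        ConnPerim.IsMinimizer ConnPerim.simplyConnectedPerimeter m lam E) →
      ConnPerim.essDiam E < ENNReal.ofReal C := by
  obtain ⟨C₁, h₁, hC₁⟩ :=
    ConnPerim.exists_essDiam_lt ConnPerim.isApproxClass_connected hm hlam
  obtain ⟨C₂, h₂, hC₂⟩ :=
    ConnPerim.exists_essDiam_lt ConnPerim.isApproxClass_simplyConnected hm hlam
  refine ⟨ConnPerim.exists_isMinimizer ConnPerim.isApproxClass_connected hm hlam,
    ConnPerim.exists_isMinimizer ConnPerim.isApproxClass_simplyConnected hm hlam,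
    max C₁ C₂, lt_max_of_lt_left h₁, ?_⟩
  rintro E (hE | hE)
  · exact (hC₁ E hE).trans_le (ENNReal.ofReal_le_ofReal (le_max_left _ _))
  · exact (hC₂ E hE).trans_le (ENNReal.ofReal_le_ofReal (le_max_right _ _))
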